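/- Let $N>1$ and let $A=[A(i,j)]_{i,j=1}^N$ be an irreducible matrix with entries in $\{0,1\}$ that is not a permutation matrix. Let $\mathcal{O}_A$ be the Cuntz–Krieger algebra of $A$, i.e. the universal unital $C^*$-algebra generated by partial isometries $S_1,\dots,S_N$ with $\sum_{j}S_jS_j^*=1$ and $S_i^*S_i=\sum_jA(i,j)S_jS_j^*$. For a word $\mu=(\mu_1,\dots,\mu_n)$ put $S_\mu=S_{\mu_1}\cdots S_{\mu_n}$, and let $\mathcal{D}_A$ be the $C^*$-subalgebra of $\mathcal{O}_A$ generated by the projections $S_\mu S_\mu^*$. Let $X_A=\{(x_n)_{n\in\mathbb{N}}\in\{1,\dots,N\}^{\mathbb N} : A(x_n,x_{n+1})=1 \text{ for all } n\}$; identify $C(X_A)$ with $\mathcal{D}_A$ so that the characteristic function of the cylinder set $U_\mu$ corresponds to $S_\mu S_\mu^*$. Fix $0<\theta<1$ and let $F_\theta(X_A)$ be the set of real-valued functions $\phi$ on $X_A$ for which there is a constant $C$ with $|\phi(x)-\phi(y)|\le C\,d_\theta(x,y)$ for all $x,y\in X_A$, where, for $x\neq y$, $d_\theta(x,y)=\theta^k$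 with $k$ the length of the longest common initial word of $x$ and $y$, and $d_\theta(x,x)=0$. For $f\in C(X_A,\mathbb{R})$ let $\gamma^f=(\gamma^f_t)_{t\in\mathbb R}$ be the action of $\mathbb{R}$ on $\mathcal{O}_A$ with $\gamma_t^f(S_j)=e^{itf}S_j$, $j=1,\dots,N$; $\gamma^1$ is the gauge action. For $\phi\in F_\theta(X_A)$ let $\lambda_\phi:\mathcal{D}_A\to\mathcal{D}_A$ be the Ruelle operator $\lambda_\phi(a)=\sum_{i=1}^NS_i^*\,a\,e^{\phi}\,S_i$. Let $E_A:\mathcal{O}_A\to\mathcal{D}_A$ be the canonical conditional expectation $E_A(T)=E_D\bigl(\frac1{2\pi}\int_0^{2\pi}\gamma^1_t(T)\,dt\bigr)$, where $E_D$ takes the diagonal part of an element of the fixed point algebra of the gauge action, that is, $E_D(T)=\lim_{n\to\infty}\sum_{|\mu|=n}S_\mu S_\mu^*\,T\,S_\mu S_\mu^*$. For $\beta>1$, a state $\psi$ on $\mathcal{O}_A$ is a $\log\beta$-KMS state for an action $\alpha$ of $\mathbb{R}$ if $\psi(y\,\alpha_{i\log\beta}(x))=\psi(xy)$ for all $y\in\mathcal{O}_A$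 and all analytic elements $x$ of $\alpha$ (those for which $t\mapsto\alpha_t(x)$ extends to an entire function $z\mapsto\alpha_z(x)$). (i) Let $f\in F_\theta(X_A)$ and $\beta>1$, and put $\phi=(1-f)\log\beta$. If $\psi$ is a $\log\beta$-KMS state on $\mathcal{O}_A$ for $\gamma^f$, then its restriction $\varphi=\psi|_{\mathcal{D}_A}$ is a state on $\mathcal{D}_A$ and satisfies $\varphi\circ\lambda_\phi=\beta\varphi$ on $\mathcal{D}_A$. (ii) Let $\phi\in F_\theta(X_A)$ and $\beta>1$, and put $f=1-\frac1{\log\beta}\phi$. If $\varphi$ is a state on $\mathcal{D}_A$ with $\varphi\circ\lambda_\phi=\beta\varphi$ on $\mathcal{D}_A$, then $\psi=\varphi\circ E_A$ is a state on $\mathcal{O}_A$ and is a $\log\beta$-KMS state for $\gamma^f$. -/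

import Mathlib

open scoped ENNReal
noncomputable section

namespace CK

/-- A square matrix with entries in `{0, 1}`. -/
structure TransitionMatrix (N : ℕ) where
  entry : Matrix (Fin N) (Fin N) ℕ
  zero_or_one : ∀ i j, entry i j = 0 ∨ entry i j = 1

/-! ### The Cuntz-Krieger algebra -/

/-- Partial isometries `T₁, …, T_N` in a unital C*-algebra satisfying the Cuntz-Krieger relations
`∑ⱼ Tⱼ Tⱼ* = 1` and `Tᵢ* Tᵢ = ∑ⱼ A(i,j) Tⱼ Tⱼ*`. -/
structure IsCKFamily {N : ℕ} (A : TransitionMatrix N) {B : Type*} [CStarAlgebra B]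
    (T : Fin N → B) : Prop where
  partial_isometry : ∀ i, T i * star (T i) * T i = T i
  sum_range : ∑ j, T j * star (T j) = 1
  source : ∀ i, star (T i) * T i = ∑ j, (A.entry i j : ℂ) • (T j * star (T j))

/-- A nonzero unital C*-algebra together with a Cuntz-Krieger family in it. A C*-algebra generated
by finitely many elements has at most the cardinality of the continuum, so C*-algebras in `Type`
suffice for the universal C*-algebra. -/
structure CKRep {N : ℕ} (A : TransitionMatrix N) : Type 1 where
  alg : Type
  [cstar : CStarAlgebra alg]
  [nontriv : Nontrivial alg]
  gen : Fin N → alg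
  isCK : IsCKFamily A gen

attribute [instance] CKRep.cstar CKRep.nontriv

variable {N : ℕ} {A : TransitionMatrix N}

theorem IsCKFamily.norm_le {B : Type*} [CStarAlgebra B] {T : Fin N → B} (hT : IsCKFamily A T)
    (i : Fin N) : ‖T i‖ ≤ 1 := by
  have h1 : star (T i) * T i * (star (T i) * T i) = star (T i) * T i := by
    rw [mul_assoc, ← mul_assoc (T i), hT.partial_isometry i]
  have h2 : ‖star (T i) * T i‖ = ‖T i‖ * ‖T i‖ := CStarRing.norm_star_mul_self
  have h3 : ‖star (T i) * T i‖ * ‖star (T i) * T i‖ = ‖star (T i) * T i‖ := by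
    have := CStarRing.norm_star_mul_self (x := star (T i) * T i)
    rw [star_mul, star_star, h1] at this
    exact this.symm
  rw [h2] at h3
  by_contra hlt
  push Not at hlt
  nlinarith [mul_pos (by linarith : 0 < ‖T i‖ - 1) (by linarith : 0 < ‖T i‖), mul_pos (by linarith : 0 < ‖T i‖) (by linarith : 0 < ‖T i‖)]

/-- The bounded (`ℓ^∞`) product of the C*-algebras of all Cuntz-Krieger families. -/
def CKProd (A : TransitionMatrix N) : Type 1 := lp (fun r : CKRep A => r.alg) ∞

instance : CStarAlgebra (lp (fun r : CKRep A => r.alg) ∞) where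
  norm_mul_self_le _ := CStarRing.norm_star_mul_self.symm.le

def CKProd.cstar (A : TransitionMatrix N) : CStarAlgebra (CKProd A) :=
  inferInstanceAs (CStarAlgebra (lp (fun r : CKRep A => r.alg) ∞))

instance : CStarAlgebra (CKProd A) := CKProd.cstar A

/-- The element of the product whose coordinates are the `j`-th members of the families. -/
def prodGen (A : TransitionMatrix N) (j : Fin N) : CKProd A :=
  ⟨fun r => r.gen j, memℓp_infty ⟨1, by rintro _ ⟨r, rfl⟩; exact r.isCK.norm_le j⟩⟩

/-- The coordinate projections of the product. -/
def evalHom (r : CKRep A) : CKProd A →⋆ₐ[ℂ] r.alg where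
  toFun x := x.1 r
  map_one' := rfl
  map_mul' _ _ := rfl
  map_zero' := rfl
  map_add' _ _ := rfl
  commutes' _ := rfl
  map_star' _ := rfl

theorem prod_ext {x y : CKProd A} (h : ∀ r, evalHom r x = evalHom r y) : x = y :=
  lp.ext (funext h)

theorem IsCKFamily.map {B C : Type*} [CStarAlgebra B] [CStarAlgebra C] {T : Fin N → B}
    (hT : IsCKFamily A T) (g : B →⋆ₐ[ℂ] C) : IsCKFamily A (fun i => g (T i)) where
  partial_isometry i := by rw [← map_star, ← map_mul, ← map_mul, hT.partial_isometry]
  sum_range := by simp_rw [← map_star, ← map_mul, ← map_sum, hT.sum_range, map_one]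
  source i := by simp_rw [← map_star, ← map_mul, hT.source, map_sum, map_smul]

theorem prodGen_isCK : IsCKFamily A (prodGen A) where
  partial_isometry i := prod_ext fun r => r.isCK.partial_isometry i
  sum_range := prod_ext fun r => by
    rw [map_sum, map_one]; exact r.isCK.sum_range
  source i := prod_ext fun r => by
    rw [map_sum]
    simp_rw [map_smul]
    exact r.isCK.source i


/-- The universal C*-algebra generated by a Cuntz-Krieger family: the C*-subalgebra, generated by
the diagonal family, of the product over all Cuntz-Krieger families. -/
def cuntzKrieger (A : TransitionMatrix N) : StarSubalgebra ℂ (CKProd A) :=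
  (StarAlgebra.adjoin ℂ (Set.range (prodGen A))).topologicalClosure

/-- The Cuntz-Krieger algebra `O_A`; for its universal property see `exists_hom` and `hom_ext`. -/
def OA (A : TransitionMatrix N) : Type 1 := cuntzKrieger A

instance : IsClosed (cuntzKrieger A : Set (CKProd A)) :=
  StarSubalgebra.isClosed_topologicalClosure _

def OA.cstar (A : TransitionMatrix N) : CStarAlgebra (OA A) :=
  StarSubalgebra.cstarAlgebra (cuntzKrieger A)

instance : CStarAlgebra (OA A) := OA.cstar A

/-- The inclusion of `O_A` into the product. -/
def OA.incl (A : TransitionMatrix N) : OA A →⋆ₐ[ℂ] CKProd A where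
  toFun x := x.1
  map_one' := rfl
  map_mul' _ _ := rfl
  map_zero' := rfl
  map_add' _ _ := rfl
  commutes' _ := rfl
  map_star' _ := rfl


/-- The generating partial isometries `S₁, …, S_N` of `O_A`. -/
def S (A : TransitionMatrix N) (j : Fin N) : OA A :=
  ⟨prodGen A j, StarSubalgebra.le_topologicalClosure _
    (StarAlgebra.subset_adjoin ℂ _ ⟨j, rfl⟩)⟩

theorem OA.incl_injective : Function.Injective (OA.incl A) := Subtype.val_injective

theorem OA.incl_S (j : Fin N) : OA.incl A (S A j) = prodGen A j := rfl

theorem S_isCK : IsCKFamily A (S A) where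
  partial_isometry i := OA.incl_injective (prodGen_isCK.partial_isometry i)
  sum_range := OA.incl_injective <| by
    rw [map_sum, map_one]; exact prodGen_isCK.sum_range
  source i := OA.incl_injective <| by
    rw [map_sum]; simp_rw [map_smul]; exact prodGen_isCK.source i

theorem hom_cont {B C : Type*} [CStarAlgebra B] [CStarAlgebra C] (g : B →⋆ₐ[ℂ] C) :
    Continuous g :=
  AddMonoidHomClass.continuous_of_bound g 1 fun x => by
    rw [one_mul]; exact NonUnitalStarAlgHom.norm_apply_le g x

/-- `O_A` is generated by `S₁, …, S_N`. -/
theorem closure_induction {p : OA A → Prop} (hcl : IsClosed {x | p x})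
    (h : ∀ x ∈ StarAlgebra.adjoin ℂ (Set.range (S A)), p x) (x : OA A) : p x := by
  obtain ⟨x, hx⟩ := x
  have key : ∀ y (hy : y ∈ StarAlgebra.adjoin ℂ (Set.range (prodGen A))),
      ∃ h' : y ∈ cuntzKrieger A, (⟨y, h'⟩ : OA A) ∈ StarAlgebra.adjoin ℂ (Set.range (S A)) := by
    intro y hy
    have := StarAlgHom.map_adjoin (OA.incl A) (Set.range (S A))
    have hr : (OA.incl A) '' (Set.range (S A)) = Set.range (prodGen A) := by
      rw [← Set.range_comp]; rfl
    rw [hr] at this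
    rw [← this] at hy
    obtain ⟨z, hz, rfl⟩ := hy
    exact ⟨z.2, hz⟩
  have hx' : x ∈ closure (StarAlgebra.adjoin ℂ (Set.range (prodGen A)) : Set (CKProd A)) := hx
  have hemb : Topology.IsInducing (OA.incl A) := Topology.IsInducing.subtypeVal
  have : (⟨x, hx⟩ : OA A) ∈ closure {x | p x} := by
    rw [hemb.closure_eq_preimage_closure_image]
    refine closure_mono ?_ hx'
    intro y hy
    obtain ⟨h', h''⟩ := key y hy
    exact ⟨⟨y, h'⟩, h _ h'', rfl⟩
  rwa [hcl.closure_eq] at this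

/-- Universal property, uniqueness: a `*`-homomorphism on `O_A` is determined on generators. -/
theorem hom_ext {B : Type*} [CStarAlgebra B] {g h : OA A →⋆ₐ[ℂ] B}
    (H : ∀ j, g (S A j) = h (S A j)) : g = h := by
  ext x
  refine closure_induction (p := fun x => g x = h x)
    (isClosed_eq (hom_cont g) (hom_cont h)) ?_ x
  intro x hx
  exact StarAlgHom.adjoin_le_equalizer g h (s := Set.range (S A)) (by rintro _ ⟨j, rfl⟩; exact H j) hx

/-- Universal property, existence: every Cuntz-Krieger family is the image of `S₁, …, S_N`. -/
theorem exists_hom {B : Type} [CStarAlgebra B] {T : Fin N → B} (hT : IsCKFamily A T) :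
    ∃ g : OA A →⋆ₐ[ℂ] B, ∀ j, g (S A j) = T j := by
  rcases subsingleton_or_nontrivial B with h | h
  · refine ⟨⟨⟨⟨⟨⟨fun _ => 0, ?_⟩, ?_⟩, ?_, ?_⟩, ?_⟩, ?_⟩, ?_⟩ <;> intros <;> exact Subsingleton.elim _ _
  · exact ⟨(evalHom ⟨B, T, hT⟩).comp (OA.incl A), fun j => rfl⟩

/-- The endomorphism of the product that replaces, in each coordinate, the generators by the images
of the given family. -/
def reindexHom (R : Fin N → OA A) (hR : IsCKFamily A R) : CKProd A →⋆ₐ[ℂ] CKProd A where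
  toFun x := ⟨fun r => x.1 ⟨r.alg, fun i => evalHom r (R i).1,
      (hR.map (OA.incl A)).map (evalHom r)⟩, by
    refine memℓp_infty ⟨‖x‖, ?_⟩
    rintro _ ⟨r, rfl⟩
    exact lp.norm_apply_le_norm (E := fun r : CKRep A => r.alg) ENNReal.top_ne_zero x _⟩
  map_one' := rfl
  map_mul' _ _ := rfl
  map_zero' := rfl
  map_add' _ _ := rfl
  commutes' _ := rfl
  map_star' _ := rfl

theorem reindexHom_mem (R : Fin N → OA A) (hR : IsCKFamily A R) (x : OA A) :
    reindexHom R hR (OA.incl A x) ∈ cuntzKrieger A := by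
  refine closure_induction (p := fun x => reindexHom R hR (OA.incl A x) ∈ cuntzKrieger A) ?_ ?_ x
  · exact (inferInstance : IsClosed (cuntzKrieger A : Set (CKProd A))).preimage
      ((hom_cont (reindexHom R hR)).comp (hom_cont (OA.incl A)))
  · intro x hx
    induction hx using StarAlgebra.adjoin_induction with
    | mem x hx => obtain ⟨j, rfl⟩ := hx; exact (R j).2
    | algebraMap r =>
      rw [AlgHomClass.commutes, AlgHomClass.commutes]
      exact (cuntzKrieger A).algebraMap_mem r
    | add x y _ _ hx hy => rw [map_add, map_add]; exact add_mem hx hy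
    | mul x y _ _ hx hy => rw [map_mul, map_mul]; exact mul_mem hx hy
    | star x _ hx => rw [map_star, map_star]; exact star_mem hx

/-- The endomorphism of `O_A` with `S_j ↦ R_j`, for a Cuntz-Krieger family `R` in `O_A`. -/
def lift (R : Fin N → OA A) (hR : IsCKFamily A R) : OA A →⋆ₐ[ℂ] OA A where
  toFun x := ⟨reindexHom R hR x.1, reindexHom_mem R hR x⟩
  map_one' := rfl
  map_mul' _ _ := rfl
  map_zero' := rfl
  map_add' _ _ := rfl
  commutes' _ := rfl
  map_star' _ := rfl

theorem lift_S (R : Fin N → OA A) (hR : IsCKFamily A R) (j : Fin N) :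
    lift R hR (S A j) = R j := by
  apply OA.incl_injective
  exact prod_ext fun r => rfl


/-! ### Words and the diagonal -/

section Words

variable {B : Type*} [CStarAlgebra B] {T : Fin N → B}

/-- `T_μ = T_{μ₁} ⋯ T_{μₙ}` for a word `μ`. -/
def word (T : Fin N → B) (μ : List (Fin N)) : B := (μ.map T).prod

/-- `T_μ T_μ*`. -/
def rangeProj (T : Fin N → B) (μ : List (Fin N)) : B := word T μ * star (word T μ)

theorem word_nil : word T [] = 1 := rfl

theorem word_cons (i : Fin N) (μ : List (Fin N)) : word T (i :: μ) = T i * word T μ := by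
  simp [word]

theorem word_append (μ ν : List (Fin N)) : word T (μ ++ ν) = word T μ * word T ν := by
  simp [word]

theorem rangeProj_nil : rangeProj T [] = 1 := by simp [rangeProj, word_nil]

theorem rangeProj_cons (i : Fin N) (μ : List (Fin N)) :
    rangeProj T (i :: μ) = T i * rangeProj T μ * star (T i) := by
  simp [rangeProj, word_cons, mul_assoc]

theorem star_rangeProj (μ : List (Fin N)) : star (rangeProj T μ) = rangeProj T μ := by
  simp [rangeProj]

theorem IsCKFamily.orth (hT : IsCKFamily A T) {i j : Fin N} (h : i ≠ j) :
    star (T i) * T j = 0 := by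
  let := CStarAlgebra.spectralOrder B
  have := CStarAlgebra.spectralOrderedRing B
  set p : Fin N → B := fun k => T k * star (T k) with hp
  have hpp : ∀ k, p k * p k = p k := fun k => by
    simp only [hp]
    rw [← mul_assoc, hT.partial_isometry k]
  have hps : ∀ k, star (p k) = p k := fun k => by simp [hp]
  have h1 : ∑ k, p j * p k * p j = p j := by
    rw [← Finset.sum_mul, ← Finset.mul_sum, hT.sum_range, mul_one, hpp]
  have h2 : ∑ k ∈ Finset.univ.erase j, p j * p k * p j = 0 := by
    have := Finset.add_sum_erase Finset.univ (fun k => p j * p k * p j) (Finset.mem_univ j)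
    rw [h1, hpp, hpp] at this
    simpa using this
  have h4 : ∀ k, p j * p k * p j = star (p k * p j) * (p k * p j) := fun k => by
    rw [star_mul, hps, hps]
    simp only [mul_assoc]
    rw [← mul_assoc (p k) (p k), hpp]
  have h3 := (Finset.sum_eq_zero_iff_of_nonneg (fun k _ => by
    rw [h4]; exact star_mul_self_nonneg _)).1 h2 i (Finset.mem_erase.2 ⟨h, Finset.mem_univ _⟩)
  rw [h4, CStarRing.star_mul_self_eq_zero_iff] at h3
  calc star (T i) * T j = star (T i * star (T i) * T i) * (T j * star (T j) * T j) := by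
        rw [hT.partial_isometry, hT.partial_isometry]
    _ = star (T i) * (p i * p j) * T j := by simp [hp, mul_assoc]
    _ = 0 := by rw [h3]; simp

theorem IsCKFamily.range_mul (hT : IsCKFamily A T) (i j : Fin N) :
    T i * star (T i) * T j = if i = j then T j else 0 := by
  split_ifs with h
  · subst h; exact hT.partial_isometry i
  · rw [mul_assoc, hT.orth h, mul_zero]

theorem IsCKFamily.source_mul (hT : IsCKFamily A T) (i j : Fin N) :
    star (T i) * T i * T j = (A.entry i j : ℂ) • T j := by
  rw [hT.source, Finset.sum_mul]
  simp [hT.range_mul]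

theorem IsCKFamily.source_mul_word (hT : IsCKFamily A T) (i j : Fin N) (μ : List (Fin N)) :
    star (T i) * T i * word T (j :: μ) = (A.entry i j : ℂ) • word T (j :: μ) := by
  rw [word_cons, ← mul_assoc, hT.source_mul, smul_mul_assoc]

theorem IsCKFamily.word_partial (hT : IsCKFamily A T) (μ : List (Fin N)) :
    rangeProj T μ * word T μ = word T μ := by
  induction μ with
  | nil => simp [rangeProj_nil]
  | cons i μ ih =>
    rw [rangeProj_cons]
    cases μ with
    | nil => simp [rangeProj_nil, word_cons, word_nil, hT.partial_isometry]
    | cons j μ =>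
      rw [word_cons i, mul_assoc, ← mul_assoc (star (T i)), hT.source_mul_word, mul_smul_comm,
        mul_assoc, ih, ← mul_smul_comm, ← hT.source_mul_word, ← mul_assoc, ← mul_assoc,
        hT.partial_isometry]

theorem IsCKFamily.word_orth (hT : IsCKFamily A T) (μ ν : List (Fin N))
    (hl : μ.length ≤ ν.length) (h : ¬ μ <+: ν) : star (word T μ) * word T ν = 0 := by
  induction μ generalizing ν with
  | nil => exact absurd (List.nil_prefix) h
  | cons i μ ih =>
    cases ν with
    | nil => simp at hl
    | cons j ν =>
      have e : star (word T (i :: μ)) * word T (j :: ν)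
          = star (word T μ) * (star (T i) * T j) * word T ν := by
        simp [word_cons, mul_assoc]
      by_cases hij : i = j
      · subst hij
        rw [List.cons_prefix_cons] at h
        have h' : ¬ μ <+: ν := fun hh => h ⟨rfl, hh⟩
        have hl' : μ.length ≤ ν.length := by simpa using hl
        cases ν with
        | nil =>
          have : μ = [] := by simpa using hl'
          exact absurd (this ▸ List.nil_prefix) h'
        | cons k ν =>
          rw [e, mul_assoc, hT.source_mul_word, mul_smul_comm, ih _ hl' h', smul_zero]
      · rw [e, hT.orth hij]; simp

theorem IsCKFamily.proj_mul_prefix (hT : IsCKFamily A T) (μ ν : List (Fin N)) :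
    rangeProj T μ * rangeProj T (μ ++ ν) = rangeProj T (μ ++ ν) := by
  conv_lhs => rw [rangeProj.eq_1 T (μ ++ ν), word_append, ← mul_assoc, ← mul_assoc,
    hT.word_partial, ← word_append]
  rfl

theorem IsCKFamily.proj_mul_orth (hT : IsCKFamily A T) (μ ν : List (Fin N))
    (hl : μ.length ≤ ν.length) (h : ¬ μ <+: ν) : rangeProj T μ * rangeProj T ν = 0 := by
  rw [rangeProj, rangeProj, mul_assoc, ← mul_assoc (star _), hT.word_orth μ ν hl h]; simp

theorem IsCKFamily.proj_comm (hT : IsCKFamily A T) (μ ν : List (Fin N)) :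
    rangeProj T μ * rangeProj T ν = rangeProj T ν * rangeProj T μ := by
  wlog hl : μ.length ≤ ν.length generalizing μ ν
  · exact (this ν μ (by omega)).symm
  have h : star (rangeProj T μ * rangeProj T ν) = rangeProj T μ * rangeProj T ν := by
    by_cases h : μ <+: ν
    · obtain ⟨γ, rfl⟩ := h
      rw [hT.proj_mul_prefix, star_rangeProj]
    · rw [hT.proj_mul_orth μ ν hl h, star_zero]
  rw [← h, star_mul, star_rangeProj, star_rangeProj]

theorem sum_words_succ {M : Type*} [AddCommMonoid M] (n : ℕ) (g : List (Fin N) → M) :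
    ∑ w : Fin (n + 1) → Fin N, g (List.ofFn w)
      = ∑ i, ∑ w : Fin n → Fin N, g (i :: List.ofFn w) := by
  rw [← (Fin.consEquiv (fun _ => Fin N)).sum_comp, Fintype.sum_prod_type]
  simp [Fin.consEquiv, List.ofFn_succ]

theorem IsCKFamily.sum_proj (hT : IsCKFamily A T) (n : ℕ) :
    ∑ w : Fin n → Fin N, rangeProj T (List.ofFn w) = 1 := by
  induction n with
  | zero => simp [rangeProj_nil]
  | succ n ih =>
    rw [sum_words_succ]
    simp_rw [rangeProj_cons, ← Finset.sum_mul, ← Finset.mul_sum, ih, mul_one]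
    exact hT.sum_range

theorem IsCKFamily.proj_idem (hT : IsCKFamily A T) (μ : List (Fin N)) :
    rangeProj T μ * rangeProj T μ = rangeProj T μ := by
  simpa using hT.proj_mul_prefix μ []

theorem IsCKFamily.sum_proj_append (hT : IsCKFamily A T) (μ : List (Fin N)) :
    ∑ i, rangeProj T (μ ++ [i]) = rangeProj T μ := by
  simp_rw [rangeProj, word_append, star_mul]
  calc _ = word T μ * (∑ i, T i * star (T i)) * star (word T μ) := by
        rw [Finset.mul_sum, Finset.sum_mul]; simp [word_cons, word_nil, mul_assoc]
    _ = _ := by rw [hT.sum_range, mul_one]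

theorem IsCKFamily.word_eq_zero (hT : IsCKFamily A T) (μ : List (Fin N)) (i j : Fin N)
    (h : A.entry i j = 0) : word T (μ ++ [i, j]) = 0 := by
  have : T i * T j = 0 := by
    rw [← hT.partial_isometry i, mul_assoc, mul_assoc, ← mul_assoc (star (T i)), hT.source_mul, h]
    simp
  rw [word_append, word_cons, word_cons, word_nil, mul_one, this, mul_zero]

end Words

/-- The C*-subalgebra of `O_A` generated by the projections `S_μ S_μ*`. Words that do not occur in
the shift space contribute only the projection `0`. -/
def diagonal (A : TransitionMatrix N) : StarSubalgebra ℂ (OA A) :=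
  (StarAlgebra.adjoin ℂ (Set.range (rangeProj (S A)))).topologicalClosure

theorem diagonal_isClosed : IsClosed (diagonal A : Set (OA A)) :=
  StarSubalgebra.isClosed_topologicalClosure _

/-- The C*-algebra `D_A`. -/
def DA (A : TransitionMatrix N) : Type 1 := diagonal A

theorem rangeProj_mem (μ : List (Fin N)) : rangeProj (S A) μ ∈ diagonal A :=
  StarSubalgebra.le_topologicalClosure _ (StarAlgebra.subset_adjoin ℂ _ ⟨μ, rfl⟩)

theorem diagonal_induction {p : OA A → Prop} (hcl : IsClosed {x | p x})
    (proj : ∀ μ, p (rangeProj (S A) μ)) (scal : ∀ c : ℂ, p (algebraMap ℂ (OA A) c))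
    (add : ∀ x ∈ diagonal A, ∀ y ∈ diagonal A, p x → p y → p (x + y))
    (mul : ∀ x ∈ diagonal A, ∀ y ∈ diagonal A, p x → p y → p (x * y))
    (st : ∀ x ∈ diagonal A, p x → p (star x)) {x : OA A} (hx : x ∈ diagonal A) : p x := by
  have : closure (StarAlgebra.adjoin ℂ (Set.range (rangeProj (S A))) : Set (OA A)) ⊆ {x | p x} := by
    refine closure_minimal ?_ hcl
    intro x hx
    have hle := StarSubalgebra.le_topologicalClosure (StarAlgebra.adjoin ℂ (Set.range (rangeProj (S A))))
    induction hx using StarAlgebra.adjoin_induction with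
    | mem x hx => obtain ⟨μ, rfl⟩ := hx; exact proj μ
    | algebraMap r => exact scal r
    | add x y h1 h2 hx hy => exact add x (hle h1) y (hle h2) hx hy
    | mul x y h1 h2 hx hy => exact mul x (hle h1) y (hle h2) hx hy
    | star x h1 hx => exact st x (hle h1) hx
  exact this hx

theorem diagonal_comm {x y : OA A} (hx : x ∈ diagonal A) (hy : y ∈ diagonal A) :
    x * y = y * x := by
  have h := StarSubalgebra.topologicalClosure_adjoin_le_centralizer_centralizer ℂ
    (Set.range (rangeProj (S A)))
  have h1 : diagonal A ≤ StarSubalgebra.centralizer ℂ (Set.range (rangeProj (S A))) := by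
    refine StarSubalgebra.topologicalClosure_minimal ?_ (Set.isClosed_centralizer _)
    rw [StarAlgebra.adjoin_le_iff]
    rintro _ ⟨μ, rfl⟩
    rw [SetLike.mem_coe, StarSubalgebra.mem_centralizer_iff]
    rintro _ ⟨ν, rfl⟩
    rw [star_rangeProj]
    exact ⟨S_isCK.proj_comm _ _, S_isCK.proj_comm _ _⟩
  have h2 := (StarSubalgebra.mem_centralizer_iff ℂ).1 (h hx) y (h1 hy)
  exact h2.1.symm

def DA.cstar (A : TransitionMatrix N) : CommCStarAlgebra (DA A) :=
  { @StarSubalgebra.cstarAlgebra _ _ _ _ _ _ _ (diagonal A) diagonal_isClosed with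
    mul_comm := fun x y => Subtype.ext (diagonal_comm x.2 y.2) }

instance : CommCStarAlgebra (DA A) := DA.cstar A

/-- The inclusion `D_A ⊆ O_A`. -/
def DA.incl (A : TransitionMatrix N) : DA A →⋆ₐ[ℂ] OA A where
  toFun x := x.1
  map_one' := rfl
  map_mul' _ _ := rfl
  map_zero' := rfl
  map_add' _ _ := rfl
  commutes' _ := rfl
  map_star' _ := rfl


/-! ### The shift space and the identification of its continuous functions with the diagonal -/

/-- The one-sided shift space `X_A` (with the product topology). -/
def ShiftSpace (A : TransitionMatrix N) : Type :=
  {x : ℕ → Fin N // ∀ n, A.entry (x n) (x (n + 1)) = 1}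

instance : TopologicalSpace (ShiftSpace A) :=
  inferInstanceAs (TopologicalSpace {x : ℕ → Fin N // ∀ n, A.entry (x n) (x (n + 1)) = 1})

/-- The word formed by the first `n` letters of `x`. -/
def pre (x : ℕ → Fin N) (n : ℕ) : List (Fin N) := (List.range n).map x

/-- The cylinder set `U_μ`. -/
def cylinder (A : TransitionMatrix N) (μ : List (Fin N)) : Set (ShiftSpace A) :=
  {x | pre x.1 μ.length = μ}

theorem pre_succ (x : ℕ → Fin N) (n : ℕ) : pre x (n + 1) = pre x n ++ [x n] := by
  simp [pre, List.range_succ]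

theorem pre_length (x : ℕ → Fin N) (n : ℕ) : (pre x n).length = n := by simp [pre]

theorem pre_add (x : ℕ → Fin N) (m n : ℕ) : ∃ γ, pre x (m + n) = pre x m ++ γ := by
  induction n with
  | zero => exact ⟨[], by simp⟩
  | succ n ih => obtain ⟨γ, h⟩ := ih; exact ⟨γ ++ [x (m + n)], by rw [← add_assoc, pre_succ, h]; simp⟩

/-- `S_μ S_μ*` as an element of `D_A`. -/
def cylProj (A : TransitionMatrix N) (μ : List (Fin N)) : DA A :=
  ⟨rangeProj (S A) μ, rangeProj_mem μ⟩

theorem DA.incl_injective : Function.Injective (DA.incl A) := Subtype.val_injective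

theorem DA.incl_cylProj (μ : List (Fin N)) : DA.incl A (cylProj A μ) = rangeProj (S A) μ := rfl

section Characters

open WeakDual

variable (χ : characterSpace ℂ (DA A))

theorem cylProj_idem (μ : List (Fin N)) : cylProj A μ * cylProj A μ = cylProj A μ :=
  DA.incl_injective (S_isCK.proj_idem μ)

theorem char_zero_or_one (μ : List (Fin N)) : χ (cylProj A μ) = 0 ∨ χ (cylProj A μ) = 1 := by
  have h : χ (cylProj A μ) * χ (cylProj A μ) = χ (cylProj A μ) := by
    rw [← map_mul, cylProj_idem]
  rcases eq_or_ne (χ (cylProj A μ)) 0 with h0 | h0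
  · exact Or.inl h0
  · exact Or.inr (mul_left_cancel₀ h0 (by rw [h, mul_one]))

theorem char_nil : χ (cylProj A []) = 1 := by
  have : cylProj A [] = 1 := DA.incl_injective (rangeProj_nil)
  rw [this, map_one]

theorem char_extend (μ : List (Fin N)) (h : χ (cylProj A μ) = 1) :
    ∃ i, χ (cylProj A (μ ++ [i])) = 1 := by
  by_contra hne
  push Not at hne
  have h0 : ∀ i, χ (cylProj A (μ ++ [i])) = 0 := fun i =>
    (char_zero_or_one χ _).resolve_right (hne i)
  have hs : ∑ i, cylProj A (μ ++ [i]) = cylProj A μ := by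
    apply DA.incl_injective
    rw [map_sum]
    exact S_isCK.sum_proj_append μ
  rw [← hs, map_sum] at h
  simp [h0] at h

theorem char_prefix (μ ν : List (Fin N)) (h : χ (cylProj A μ) = 1) (h' : χ (cylProj A ν) = 1)
    (hl : μ.length ≤ ν.length) : μ <+: ν := by
  by_contra hn
  have : cylProj A μ * cylProj A ν = 0 := DA.incl_injective <| by
    rw [map_zero]; exact S_isCK.proj_mul_orth μ ν hl hn
  have h2 : χ (cylProj A μ) * χ (cylProj A ν) = 0 := by rw [← map_mul, this, map_zero]
  rw [h, h'] at h2
  simp at h2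

theorem char_unique (μ ν : List (Fin N)) (h : χ (cylProj A μ) = 1) (h' : χ (cylProj A ν) = 1)
    (hl : μ.length = ν.length) : μ = ν :=
  (char_prefix χ μ ν h h' hl.le).eq_of_length hl

theorem char_exists_point : ∃ x : ShiftSpace A, ∀ n, χ (cylProj A (pre x.1 n)) = 1 := by
  have : Nonempty (Fin N) := ⟨(char_extend χ [] (char_nil χ)).choose⟩
  choose! next hnext using char_extend χ
  let seq : ℕ → List (Fin N) := fun n => Nat.rec [] (fun _ μ => μ ++ [next μ]) n
  have hs : ∀ n, χ (cylProj A (seq n)) = 1 := by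
    intro n
    induction n with
    | zero => exact char_nil χ
    | succ n ih => exact hnext _ ih
  have hpre : ∀ n, pre (fun k => next (seq k)) n = seq n := by
    intro n
    induction n with
    | zero => rfl
    | succ n ih => rw [pre_succ, ih]
  refine ⟨⟨fun k => next (seq k), fun n => ?_⟩, fun n => ?_⟩
  · refine (A.zero_or_one _ _).resolve_left fun h0 => ?_
    have h1 : χ (cylProj A (pre (fun k => next (seq k)) (n + 2))) = 1 := by
      rw [hpre (n + 2)]; exact hs (n + 2)
    rw [pre_succ, pre_succ, List.append_assoc] at h1
    have : cylProj A (pre (fun k => next (seq k)) n ++ [next (seq n), next (seq (n + 1))]) = 0 :=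
      DA.incl_injective <| by
        rw [map_zero, DA.incl_cylProj, rangeProj, S_isCK.word_eq_zero _ _ _ h0, zero_mul]
    rw [show [next (seq n)] ++ [next (seq (n + 1))] = [next (seq n), next (seq (n + 1))] from rfl,
      this, map_zero] at h1
    exact zero_ne_one h1
  · exact (congrArg (fun μ => χ (cylProj A μ)) (hpre n)).trans (hs n)

/-- The point `x` of `X_A` with `χ(S_μ S_μ*) = 1` for all initial words `μ` of `x`. -/
def charPoint : ShiftSpace A := (char_exists_point χ).choose

theorem charPoint_spec (n : ℕ) : χ (cylProj A (pre (charPoint χ).1 n)) = 1 :=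
  (char_exists_point χ).choose_spec n

theorem continuous_charPoint : Continuous (charPoint (A := A)) := by
  have : Continuous (fun χ : characterSpace ℂ (DA A) => (charPoint χ).1) := by
    refine continuous_pi fun n => continuous_discrete_rng.2 fun i => ?_
    rw [isOpen_iff_mem_nhds]
    intro χ hχ
    set w := pre (charPoint χ).1 (n + 1) with hw
    have hc : Continuous (fun χ' : characterSpace ℂ (DA A) => χ' (cylProj A w)) :=
      (WeakDual.eval_continuous (cylProj A w)).comp continuous_subtype_val
    have hU : (fun χ' : characterSpace ℂ (DA A) => χ' (cylProj A w)) ⁻¹' {0}ᶜ ∈ nhds χ := by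
      refine (isOpen_compl_singleton.preimage hc).mem_nhds ?_
      simp [hw, charPoint_spec]
    filter_upwards [hU] with χ' hχ'
    have h1 : χ' (cylProj A w) = 1 := (char_zero_or_one χ' w).resolve_left hχ'
    have h2 := char_unique χ' _ _ (charPoint_spec χ' (n + 1)) h1 (by rw [hw, pre_length, pre_length])
    rw [hw, pre_succ, pre_succ] at h2
    have h3 := List.append_inj_right' h2 rfl
    simp only [Set.mem_preimage, Set.mem_singleton_iff] at hχ ⊢
    rw [← hχ]
    simpa using h3
  exact Continuous.subtype_mk this _

end Characters

/-- The identification `C(X_A) → D_A`, `1_{U_μ} ↦ S_μ S_μ*` (see `embed_cylinder`), obtained by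
composing the Gelfand transform of `D_A` with the map that sends a character to a point of `X_A`. -/
def embed (A : TransitionMatrix N) : C(ShiftSpace A, ℂ) →⋆ₐ[ℂ] DA A :=
  ((gelfandStarTransform (DA A)).symm : C(WeakDual.characterSpace ℂ (DA A), ℂ) →⋆ₐ[ℂ] DA A).comp
    (ContinuousMap.compStarAlgHom' ℂ ℂ ⟨charPoint, continuous_charPoint⟩)

/-- `1_{U_μ} ↦ S_μ S_μ*`; as cylinder functions span a dense subspace of `C(X_A)`, this determines
`embed`. -/
theorem embed_cylinder (μ : List (Fin N)) (g : C(ShiftSpace A, ℂ))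
    (hg : ∀ x, g x = (cylinder A μ).indicator 1 x) : embed A g = cylProj A μ := by
  apply EquivLike.injective (gelfandStarTransform (DA A))
  ext χ
  have h1 : gelfandStarTransform (DA A) (embed A g) χ = g (charPoint χ) := by
    change gelfandStarTransform (DA A) ((gelfandStarTransform (DA A)).symm _) χ = _
    rw [StarAlgEquiv.apply_symm_apply]
    rfl
  have h2 : gelfandStarTransform (DA A) (cylProj A μ) χ = χ (cylProj A μ) := rfl
  rw [h1, h2, hg]
  by_cases h : charPoint χ ∈ cylinder A μ
  · rw [Set.indicator_of_mem h]
    have : pre (charPoint χ).1 μ.length = μ := h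
    conv_rhs => rw [← this]
    rw [charPoint_spec]
    rfl
  · rw [Set.indicator_of_notMem h]
    refine ((char_zero_or_one χ μ).resolve_right fun h1 => h ?_).symm
    exact char_unique χ _ _ (charPoint_spec χ _) h1 (pre_length _ _)


/-! ### Generalized gauge actions -/

/-- The function `exp(i t f)`. -/
def phase (f : C(ShiftSpace A, ℝ)) (t : ℝ) : C(ShiftSpace A, ℂ) where
  toFun x := Complex.exp (Complex.I * t * f x)
  continuous_toFun := by fun_prop

theorem phase_add (f : C(ShiftSpace A, ℝ)) (s t : ℝ) :
    phase f (s + t) = phase f s * phase f t := by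
  ext x
  simp [phase, ← Complex.exp_add]
  congr 1; ring

theorem phase_zero (f : C(ShiftSpace A, ℝ)) : phase f 0 = 1 := by
  ext x; simp [phase]

theorem star_phase (f : C(ShiftSpace A, ℝ)) (t : ℝ) : star (phase f t) = phase f (-t) := by
  ext x
  simp [phase, ← Complex.exp_conj]

/-- The unitary `V_t(f) = exp(i t f)` in `D_A ⊆ O_A`. -/
def V (f : C(ShiftSpace A, ℝ)) (t : ℝ) : OA A := DA.incl A (embed A (phase f t))

theorem V_mem (f : C(ShiftSpace A, ℝ)) (t : ℝ) : V f t ∈ diagonal A := (embed A (phase f t)).2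

theorem V_add (f : C(ShiftSpace A, ℝ)) (s t : ℝ) : V f (s + t) = V f s * V f t := by
  simp [V, phase_add]

theorem V_zero (f : C(ShiftSpace A, ℝ)) : V f 0 = 1 := by simp [V, phase_zero]

theorem star_V (f : C(ShiftSpace A, ℝ)) (t : ℝ) : star (V f t) = V f (-t) := by
  rw [V, ← map_star, ← map_star, star_phase]; rfl

theorem star_V_mul (f : C(ShiftSpace A, ℝ)) (t : ℝ) : star (V f t) * V f t = 1 := by
  rw [star_V, ← V_add, neg_add_cancel, V_zero]

theorem V_mul_star (f : C(ShiftSpace A, ℝ)) (t : ℝ) : V f t * star (V f t) = 1 := by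
  rw [star_V, ← V_add, add_neg_cancel, V_zero]

theorem V_conj (f : C(ShiftSpace A, ℝ)) (t : ℝ) {d : OA A} (hd : d ∈ diagonal A) :
    V f t * d * star (V f t) = d := by
  rw [diagonal_comm (V_mem f t) hd, mul_assoc, V_mul_star, mul_one]

theorem S_range (j : Fin N) : S A j * star (S A j) = rangeProj (S A) [j] := by
  simp [rangeProj, word]

theorem twist_isCK (f : C(ShiftSpace A, ℝ)) (t : ℝ) :
    IsCKFamily A (fun j => V f t * S A j) := by
  have h : ∀ j, V f t * S A j * star (V f t * S A j) = S A j * star (S A j) := fun j => by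
    rw [star_mul, ← mul_assoc, mul_assoc (V f t) (S A j), V_conj]
    rw [S_range]; exact rangeProj_mem _
  have h' : ∀ j, star (V f t * S A j) * (V f t * S A j) = star (S A j) * S A j := fun j => by
    rw [star_mul, mul_assoc, ← mul_assoc (star (V f t)), star_V_mul, one_mul]
  refine ⟨fun i => ?_, ?_, fun i => ?_⟩
  · rw [mul_assoc, h', mul_assoc, ← mul_assoc (S A i), S_isCK.partial_isometry]
  · simp_rw [h]; exact S_isCK.sum_range
  · simp_rw [h, h']; exact S_isCK.source i

/-- `γ_t^f` as an endomorphism: `S_j ↦ V_t(f) S_j`. -/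
def gammaHom (f : C(ShiftSpace A, ℝ)) (t : ℝ) : OA A →⋆ₐ[ℂ] OA A :=
  lift (fun j => V f t * S A j) (twist_isCK f t)

theorem gammaHom_S (f : C(ShiftSpace A, ℝ)) (t : ℝ) (j : Fin N) :
    gammaHom f t (S A j) = V f t * S A j := lift_S _ _ j

theorem gammaHom_proj (f : C(ShiftSpace A, ℝ)) (t : ℝ) (μ : List (Fin N)) :
    gammaHom f t (rangeProj (S A) μ) = rangeProj (S A) μ := by
  induction μ with
  | nil => rw [rangeProj_nil, map_one]
  | cons i μ ih =>
    rw [rangeProj_cons, map_mul, map_mul, ih, map_star, gammaHom_S, star_mul]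
    calc _ = V f t * (S A i * rangeProj (S A) μ * star (S A i)) * star (V f t) := by
          simp only [mul_assoc]
      _ = _ := V_conj f t (by rw [← rangeProj_cons]; exact rangeProj_mem _)

theorem gammaHom_diagonal (f : C(ShiftSpace A, ℝ)) (t : ℝ) {d : OA A} (hd : d ∈ diagonal A) :
    gammaHom f t d = d := by
  refine diagonal_induction (p := fun d => gammaHom f t d = d)
    (isClosed_eq (hom_cont _) continuous_id) (gammaHom_proj f t) (fun c => AlgHomClass.commutes _ c)
    (fun x _ y _ hx hy => by rw [map_add, hx, hy]) (fun x _ y _ hx hy => by rw [map_mul, hx, hy])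
    (fun x _ hx => by rw [map_star, hx]) hd

theorem gammaHom_add (f : C(ShiftSpace A, ℝ)) (s t : ℝ) (x : OA A) :
    gammaHom f s (gammaHom f t x) = gammaHom f (s + t) x := by
  have : (gammaHom f s).comp (gammaHom f t) = gammaHom f (s + t) := hom_ext fun j => by
    rw [StarAlgHom.comp_apply, gammaHom_S, map_mul, gammaHom_diagonal f s (V_mem f t), gammaHom_S,
      gammaHom_S, ← mul_assoc, ← V_add, add_comm]
  exact DFunLike.congr_fun this x

theorem gammaHom_zero (f : C(ShiftSpace A, ℝ)) (x : OA A) : gammaHom f 0 x = x := by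
  have : gammaHom f 0 = StarAlgHom.id ℂ (OA A) := hom_ext fun j => by
    rw [gammaHom_S, V_zero, one_mul]; rfl
  exact DFunLike.congr_fun this x

/-- The automorphism `γ_t^f` of `O_A`, with `γ_t^f(S_j) = V_t(f) S_j`. -/
def gamma (f : C(ShiftSpace A, ℝ)) (t : ℝ) : OA A ≃⋆ₐ[ℂ] OA A :=
  StarAlgEquiv.ofStarAlgHom (gammaHom f t) (gammaHom f (-t))
    (StarAlgHom.ext fun x => by
      simp [gammaHom_add, gammaHom_zero])
    (StarAlgHom.ext fun x => by
      simp [gammaHom_add, gammaHom_zero])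

theorem gamma_S (f : C(ShiftSpace A, ℝ)) (t : ℝ) (j : Fin N) :
    gamma f t (S A j) = V f t * S A j := gammaHom_S f t j

/-! ### The Ruelle operator -/

/-- The function `e^p`. -/
def expFun (p : C(ShiftSpace A, ℝ)) : C(ShiftSpace A, ℂ) where
  toFun x := ((Real.exp (p x) : ℝ) : ℂ)
  continuous_toFun := by fun_prop

theorem conj_S_mem (i : Fin N) {d : OA A} (hd : d ∈ diagonal A) :
    star (S A i) * d * S A i ∈ diagonal A := by
  have hq : star (S A i) * S A i ∈ diagonal A := by
    rw [S_isCK.source]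
    refine sum_mem fun j _ => SMulMemClass.smul_mem _ ?_
    rw [S_range]; exact rangeProj_mem _
  refine diagonal_induction (p := fun d => star (S A i) * d * S A i ∈ diagonal A)
    (diagonal_isClosed.preimage (by fun_prop)) ?_ ?_ ?_ ?_ ?_ hd
  · intro μ
    cases μ with
    | nil => rw [rangeProj_nil, mul_one]; exact hq
    | cons j μ =>
      rw [rangeProj_cons]
      by_cases h : i = j
      · subst h
        have : star (S A i) * (S A i * rangeProj (S A) μ * star (S A i)) * S A i
            = (star (S A i) * S A i) * rangeProj (S A) μ * (star (S A i) * S A i) := by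
          simp only [mul_assoc]
        rw [this]
        exact mul_mem (mul_mem hq (rangeProj_mem μ)) hq
      · rw [mul_assoc (S A j), ← mul_assoc (star (S A i)), S_isCK.orth h, zero_mul, zero_mul]
        exact zero_mem _
  · intro c
    rw [← Algebra.commutes, mul_assoc]
    exact mul_mem ((diagonal A).algebraMap_mem c) hq
  · intro x _ y _ hx hy
    rw [mul_add, add_mul]; exact add_mem hx hy
  · intro x hx0 y _ hx hy
    have hp : S A i * star (S A i) ∈ diagonal A := by rw [S_range]; exact rangeProj_mem _
    have : star (S A i) * (x * y) * S A i
        = (star (S A i) * x * S A i) * (star (S A i) * y * S A i) := by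
      calc _ = star (S A i * star (S A i) * S A i) * (x * y) * S A i := by
            rw [S_isCK.partial_isometry]
        _ = star (S A i) * ((S A i * star (S A i)) * x) * y * S A i := by
            simp [mul_assoc]
        _ = _ := by rw [diagonal_comm hp hx0]; simp only [mul_assoc]
    rw [this]; exact mul_mem hx hy
  · intro x _ hx
    have := star_mem hx
    simpa [mul_assoc] using this

/-- The Ruelle operator `λ_φ(a) = ∑ S_i^* a e^φ S_i` on `D_A`. -/
def ruelle (p : C(ShiftSpace A, ℝ)) (a : DA A) : DA A :=
  ⟨∑ i, star (S A i) * DA.incl A (a * embed A (expFun p)) * S A i,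
    sum_mem fun i _ => conj_S_mem i (a * embed A (expFun p)).2⟩

/-! ### States and the KMS condition -/

/-- `ω` is a state: a continuous positive linear functional with `ω(1) = 1`. -/
structure IsState {B : Type*} [CStarAlgebra B] (ω : B →L[ℂ] ℂ) : Prop where
  nonneg : ∀ a, 0 ≤ (ω (star a * a)).re ∧ (ω (star a * a)).im = 0
  map_one : ω 1 = 1

/-- `F` is an entire function extending `t ↦ α_t(x)`. Such an `F` exists exactly when `x` is an
analytic element of the action; it is then unique, and `F z` is `α_z(x)`. -/
def IsEntireExtension {B : Type*} [CStarAlgebra B] (α : ℝ → B ≃⋆ₐ[ℂ] B) (x : B) (F : ℂ → B) :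
    Prop :=
  Differentiable ℂ F ∧ ∀ t : ℝ, F t = α t x

/-- `ω` is an `s`-KMS state for `α`: a state with `ω(y α_{is}(x)) = ω(x y)` for all analytic `x` and
all `y`. -/
def IsKMS {B : Type*} [CStarAlgebra B] (α : ℝ → B ≃⋆ₐ[ℂ] B) (s : ℝ) (ω : B →L[ℂ] ℂ) : Prop :=
  IsState ω ∧ ∀ (x : B) (F : ℂ → B), IsEntireExtension α x F →
    ∀ y : B, ω (y * F (Complex.I * s)) = ω (x * y)


/-! ### The canonical conditional expectation -/

section Expectation

/-- The elements `S_μ S_ν*`. -/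
def monomials (A : TransitionMatrix N) : Set (OA A) :=
  Set.range fun p : List (Fin N) × List (Fin N) => word (S A) p.1 * star (word (S A) p.2)

theorem mono_mem (μ ν : List (Fin N)) :
    word (S A) μ * star (word (S A) ν) ∈ Submodule.span ℂ (monomials A) :=
  Submodule.subset_span ⟨(μ, ν), rfl⟩

theorem span_left (a : OA A)
    (h : ∀ μ ν, a * (word (S A) μ * star (word (S A) ν)) ∈ Submodule.span ℂ (monomials A))
    {x : OA A} (hx : x ∈ Submodule.span ℂ (monomials A)) :
    a * x ∈ Submodule.span ℂ (monomials A) := by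
  induction hx using Submodule.span_induction with
  | mem x hx => obtain ⟨p, rfl⟩ := hx; exact h _ _
  | zero => rw [mul_zero]; exact zero_mem _
  | add x y _ _ hx hy => rw [mul_add]; exact add_mem hx hy
  | smul c x _ hx => rw [mul_smul_comm]; exact Submodule.smul_mem _ _ hx

theorem S_mul_mono (i : Fin N) (μ ν : List (Fin N)) :
    S A i * (word (S A) μ * star (word (S A) ν)) ∈ Submodule.span ℂ (monomials A) := by
  rw [← mul_assoc, ← word_cons]; exact mono_mem _ _

theorem star_S_mul_mono (i : Fin N) (μ ν : List (Fin N)) :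
    star (S A i) * (word (S A) μ * star (word (S A) ν)) ∈ Submodule.span ℂ (monomials A) := by
  cases μ with
  | nil =>
    have : star (S A i) * (word (S A) [] * star (word (S A) ν))
        = word (S A) [] * star (word (S A) (ν ++ [i])) := by
      simp [word_append, word_nil, word_cons]
    rw [this]; exact mono_mem _ _
  | cons j μ =>
    rw [word_cons, mul_assoc, ← mul_assoc]
    by_cases h : i = j
    · subst h
      rw [S_isCK.source, Finset.sum_mul]
      refine sum_mem fun k _ => ?_
      rw [smul_mul_assoc]
      refine Submodule.smul_mem _ _ ?_
      cases μ with
      | nil =>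
        have : S A k * star (S A k) * (word (S A) [] * star (word (S A) ν))
            = word (S A) [k] * star (word (S A) (ν ++ [k])) := by
          simp [word_append, word_nil, word_cons, mul_assoc]
        rw [this]; exact mono_mem _ _
      | cons l μ =>
        rw [word_cons, mul_assoc (S A l), ← mul_assoc, S_isCK.range_mul]
        split_ifs with hkl
        · exact S_mul_mono _ _ _
        · rw [zero_mul]; exact zero_mem _
    · rw [S_isCK.orth h, zero_mul]; exact zero_mem _

theorem monomial_induction {p : OA A → Prop} (hcl : IsClosed {x | p x})
    (mono : ∀ μ ν, p (word (S A) μ * star (word (S A) ν)))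
    (add : ∀ x y, p x → p y → p (x + y)) (smul : ∀ (c : ℂ) x, p x → p (c • x)) (x : OA A) :
    p x := by
  refine closure_induction hcl (fun x hx => ?_) x
  have hx' : x ∈ Submodule.span ℂ (monomials A) := by
    have key : ∀ y ∈ Submodule.span ℂ (monomials A),
        x * y ∈ Submodule.span ℂ (monomials A) := by
      rw [← StarSubalgebra.mem_toSubalgebra, StarAlgebra.adjoin_toSubalgebra] at hx
      induction hx using Algebra.adjoin_induction with
      | mem x hx =>
        rcases hx with ⟨i, rfl⟩ | hx
        · exact fun y => span_left _ (S_mul_mono i)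
        · obtain ⟨i, hi⟩ := hx
          have : x = star (S A i) := by rw [hi, star_star]
          rw [this]
          exact fun y => span_left _ (star_S_mul_mono i)
      | algebraMap r =>
        intro y hy
        rw [← Algebra.smul_def]; exact Submodule.smul_mem _ _ hy
      | add a b _ _ ha hb => intro y hy; rw [add_mul]; exact add_mem (ha y hy) (hb y hy)
      | mul a b _ _ ha hb => intro y hy; rw [mul_assoc]; exact ha _ (hb y hy)
    have h1 : (1 : OA A) ∈ Submodule.span ℂ (monomials A) := by
      have := mono_mem (A := A) [] []
      simpa [word_nil] using this
    simpa using key 1 h1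
  clear hx
  induction hx' using Submodule.span_induction with
  | mem x hx => obtain ⟨q, rfl⟩ := hx; exact mono _ _
  | zero => simpa using smul 0 _ (mono [] [])
  | add x y _ _ hx hy => exact add x y hx hy
  | smul c x _ hx => exact smul c x hx

/-- The gauge action is `γ^1`. -/
theorem gauge_word (t : ℝ) (μ : List (Fin N)) :
    gamma (1 : C(ShiftSpace A, ℝ)) t (word (S A) μ)
      = Complex.exp (Complex.I * t * μ.length) • word (S A) μ := by
  have hV : V (1 : C(ShiftSpace A, ℝ)) t = algebraMap ℂ _ (Complex.exp (Complex.I * t)) := by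
    have : phase (1 : C(ShiftSpace A, ℝ)) t = algebraMap ℂ _ (Complex.exp (Complex.I * t)) := by
      ext x; simp [phase]
    rw [V, this, AlgHomClass.commutes, AlgHomClass.commutes]
  induction μ with
  | nil => simp [word_nil]
  | cons i μ ih =>
    rw [word_cons, map_mul, ih, gamma_S, hV, ← Algebra.smul_def, smul_mul_smul_comm,
      ← Complex.exp_add]
    congr 2
    push_cast [List.length_cons]
    ring

theorem gauge_mono (t : ℝ) (μ ν : List (Fin N)) :
    gamma (1 : C(ShiftSpace A, ℝ)) t (word (S A) μ * star (word (S A) ν))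
      = Complex.exp (Complex.I * ((μ.length : ℂ) - ν.length) * t)
        • (word (S A) μ * star (word (S A) ν)) := by
  rw [map_mul, map_star, gauge_word, gauge_word, star_smul, smul_mul_smul_comm]
  congr 1
  rw [show star (Complex.exp (Complex.I * t * ν.length))
    = Complex.exp (-(Complex.I * t * ν.length)) by simp [← Complex.exp_conj], ← Complex.exp_add]
  congr 1; ring

theorem gamma_norm (f : C(ShiftSpace A, ℝ)) (t : ℝ) (x : OA A) : ‖gamma f t x‖ ≤ ‖x‖ :=
  NonUnitalStarAlgHom.norm_apply_le (gamma f t) x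

theorem gauge_continuous (x : OA A) :
    Continuous fun t : ℝ => gamma (1 : C(ShiftSpace A, ℝ)) t x := by
  refine monomial_induction (p := fun x => Continuous fun t : ℝ =>
    gamma (1 : C(ShiftSpace A, ℝ)) t x) ?_ ?_ ?_ ?_ x
  · refine isClosed_of_closure_subset fun x hx => ?_
    refine continuous_of_uniform_approx_of_continuous fun u hu => ?_
    obtain ⟨ε, hε, h⟩ := Metric.mem_uniformity_dist.1 hu
    obtain ⟨y, hy, hxy⟩ := Metric.mem_closure_iff.1 hx ε hε
    refine ⟨_, hy, fun t => h ?_⟩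
    rw [dist_eq_norm, ← map_sub]
    exact (gamma_norm _ _ _).trans_lt (by rwa [← dist_eq_norm])
  · intro μ ν
    simp_rw [gauge_mono]
    fun_prop
  · intro x y hx hy; simp_rw [map_add]; exact hx.add hy
  · intro c x hx; simp_rw [map_smul]; exact hx.const_smul c

/-- `(1/2π) ∫_0^{2π} γ_t(x) dt`, the average of `x` over the gauge action, which maps `O_A` onto the
fixed point algebra `F_A`. -/
def gaugeMean (x : OA A) : OA A :=
  ((2 * Real.pi)⁻¹ : ℂ) • ∫ t in (0 : ℝ)..(2 * Real.pi), gamma (1 : C(ShiftSpace A, ℝ)) t x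

theorem gaugeMean_add (x y : OA A) : gaugeMean (x + y) = gaugeMean x + gaugeMean y := by
  simp only [gaugeMean, map_add]
  rw [intervalIntegral.integral_add ((gauge_continuous x).intervalIntegrable _ _)
    ((gauge_continuous y).intervalIntegrable _ _), smul_add]

theorem gaugeMean_smul (c : ℂ) (x : OA A) : gaugeMean (c • x) = c • gaugeMean x := by
  simp only [gaugeMean, map_smul]
  rw [intervalIntegral.integral_smul, smul_comm]

theorem gaugeMean_norm (x : OA A) : ‖gaugeMean x‖ ≤ ‖x‖ := by
  have h := intervalIntegral.norm_integral_le_of_norm_le_const (a := 0) (b := 2 * Real.pi)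
    (f := fun t => gamma (1 : C(ShiftSpace A, ℝ)) t x) (fun t _ => gamma_norm _ t x)
  have hp := Real.two_pi_pos
  rw [sub_zero, abs_of_pos hp] at h
  rw [gaugeMean, norm_smul]
  have : ‖((2 * Real.pi)⁻¹ : ℂ)‖ = (2 * Real.pi)⁻¹ := by
    rw [norm_inv]; congr 1
    rw [show (2 * Real.pi : ℂ) = ((2 * Real.pi : ℝ) : ℂ) by push_cast; rfl, Complex.norm_real,
      Real.norm_of_nonneg hp.le]
  rw [this, inv_mul_le_iff₀ hp, mul_comm (2 * Real.pi)]
  exact h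

theorem gaugeMean_mono (μ ν : List (Fin N)) :
    gaugeMean (word (S A) μ * star (word (S A) ν))
      = if μ.length = ν.length then word (S A) μ * star (word (S A) ν) else 0 := by
  have hpi : (Real.pi : ℂ) ≠ 0 := by exact_mod_cast Real.pi_ne_zero
  simp only [gaugeMean, gauge_mono]
  rw [intervalIntegral.integral_smul_const]
  split_ifs with h
  · rw [h, smul_smul]
    have : (Real.pi : ℂ)⁻¹ * 2⁻¹ * (2 * Real.pi) = 1 := by field_simp
    simp [this]
  · have hc : Complex.I * ((μ.length : ℂ) - ν.length) ≠ 0 := by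
      refine mul_ne_zero Complex.I_ne_zero (sub_ne_zero.2 ?_)
      exact_mod_cast h
    rw [integral_exp_mul_complex hc]
    have : Complex.exp (Complex.I * ((μ.length : ℂ) - ν.length) * ((2 * Real.pi : ℝ) : ℂ)) = 1 := by
      rw [Complex.exp_eq_one_iff]
      exact ⟨(μ.length : ℤ) - ν.length, by push_cast; ring⟩
    rw [this]
    simp

/-- `∑_{|w| = n} S_w S_w* x S_w S_w*`: the diagonal part of `x` with respect to the words of
length `n`. -/
def pinch (n : ℕ) (x : OA A) : OA A :=
  ∑ w : Fin n → Fin N, rangeProj (S A) (List.ofFn w) * x * rangeProj (S A) (List.ofFn w)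

theorem pinch_add (n : ℕ) (x y : OA A) : pinch n (x + y) = pinch n x + pinch n y := by
  simp [pinch, mul_add, add_mul, Finset.sum_add_distrib]

theorem pinch_smul (n : ℕ) (c : ℂ) (x : OA A) : pinch n (c • x) = c • pinch n x := by
  simp [pinch, Finset.smul_sum]

theorem pinch_norm (n : ℕ) (x : OA A) : ‖pinch n x‖ ≤ ‖x‖ := by
  let := CStarAlgebra.spectralOrder (OA A)
  have := CStarAlgebra.spectralOrderedRing (OA A)
  let P : (Fin n → Fin N) → OA A := fun w => rangeProj (S A) (List.ofFn w)
  have hPs : ∀ w, star (P w) = P w := fun w => star_rangeProj _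
  have hPP : ∀ w, P w * P w = P w := fun w => S_isCK.proj_idem _
  have hPo : ∀ w v, w ≠ v → P w * P v = 0 := fun w v h =>
    S_isCK.proj_mul_orth _ _ (by simp) fun hp =>
      h (List.ofFn_injective (hp.eq_of_length (by simp)))
  have e1 : star (pinch n x) * pinch n x = ∑ w, P w * star x * P w * x * P w := by
    change star (∑ w, P w * x * P w) * (∑ w, P w * x * P w) = _
    rw [star_sum, Finset.sum_mul]
    refine Finset.sum_congr rfl fun w _ => ?_
    rw [Finset.mul_sum, Finset.sum_eq_single w]
    · rw [star_mul, star_mul, hPs]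
      simp only [mul_assoc]
      rw [← mul_assoc (P w) (P w), hPP]
    · intro v _ hv
      rw [star_mul, star_mul, hPs]
      simp only [mul_assoc]
      rw [← mul_assoc (P w) (P v), hPo w v hv.symm]; simp
    · simp
  have e2 : star (pinch n x) * pinch n x ≤ algebraMap ℝ (OA A) (‖x‖ * ‖x‖) := by
    calc star (pinch n x) * pinch n x = ∑ w, P w * star x * P w * x * P w := e1
      _ ≤ ∑ w, star (P w) * (star x * x) * P w := by
        refine Finset.sum_le_sum fun w _ => ?_
        rw [← sub_nonneg]
        have : star (P w) * (star x * x) * P w - P w * star x * P w * x * P w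
            = star ((1 - P w) * x * P w) * ((1 - P w) * x * P w) := by
          have h1 : (1 - P w) * (1 - P w) = 1 - P w := by
            simp [mul_sub, sub_mul, hPP]
          calc _ = P w * star x * (1 - P w) * x * P w := by
                rw [hPs]; simp [mul_sub, sub_mul, mul_assoc]
            _ = P w * star x * ((1 - P w) * (1 - P w)) * x * P w := by rw [h1]
            _ = _ := by
              rw [star_mul, star_mul, star_sub, star_one, hPs]; simp only [mul_assoc]
        rw [this]; exact star_mul_self_nonneg _
      _ ≤ ∑ w, star (P w) * algebraMap ℝ (OA A) ‖star x * x‖ * P w := by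
        refine Finset.sum_le_sum fun w _ => ?_
        exact star_left_conjugate_le_conjugate
          (IsSelfAdjoint.le_algebraMap_norm_self (IsSelfAdjoint.star_mul_self x)) _
      _ = algebraMap ℝ (OA A) ‖star x * x‖ := by
        have : ∀ w, star (P w) * algebraMap ℝ (OA A) ‖star x * x‖ * P w
            = algebraMap ℝ (OA A) ‖star x * x‖ * P w := fun w => by
          rw [hPs, ← Algebra.commutes, mul_assoc, hPP]
        simp_rw [this, ← Finset.mul_sum]
        rw [show ∑ w, P w = 1 from S_isCK.sum_proj n, mul_one]
      _ = _ := by rw [CStarRing.norm_star_mul_self]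
  have e3 := CStarAlgebra.norm_le_norm_of_nonneg_of_le (star_mul_self_nonneg _) e2
  rw [CStarRing.norm_star_mul_self] at e3
  have e4 : ‖algebraMap ℝ (OA A) (‖x‖ * ‖x‖)‖ ≤ ‖x‖ * ‖x‖ := by
    rcases subsingleton_or_nontrivial (OA A) with h | h
    · rw [Subsingleton.elim (algebraMap ℝ (OA A) (‖x‖ * ‖x‖)) 0, norm_zero]; positivity
    · rw [norm_algebraMap', Real.norm_of_nonneg (by positivity)]
  exact abs_le_of_sq_le_sq' (by nlinarith) (norm_nonneg x) |>.2

theorem pinch_mono (n : ℕ) (μ ν : List (Fin N)) (hl : μ.length = ν.length) (hn : μ.length ≤ n) :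
    pinch n (word (S A) μ * star (word (S A) ν)) = if μ = ν then rangeProj (S A) μ else 0 := by
  split_ifs with h
  · subst h
    change ∑ w : Fin n → Fin N, _ * rangeProj (S A) μ * _ = _
    have : ∀ w : Fin n → Fin N, rangeProj (S A) (List.ofFn w) * rangeProj (S A) μ
        * rangeProj (S A) (List.ofFn w) = rangeProj (S A) μ * rangeProj (S A) (List.ofFn w) :=
      fun w => by rw [S_isCK.proj_comm, mul_assoc, S_isCK.proj_idem]
    simp_rw [this, ← Finset.mul_sum, S_isCK.sum_proj, mul_one]
  · refine Finset.sum_eq_zero fun w _ => ?_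
    by_cases hμ : μ <+: List.ofFn w
    · have hν : ¬ ν <+: List.ofFn w := fun hν =>
        h ((List.prefix_of_prefix_length_le hμ hν hl.le).eq_of_length hl)
      have := S_isCK.word_orth (T := S A) ν (List.ofFn w) (by rw [List.length_ofFn]; omega) hν
      rw [mul_assoc, mul_assoc, rangeProj, ← mul_assoc (star (word (S A) ν)), this]
      simp
    · have := S_isCK.word_orth (T := S A) μ (List.ofFn w) (by rw [List.length_ofFn]; omega) hμ
      have h2 := congrArg star this
      rw [star_mul, star_star, star_zero] at h2
      rw [rangeProj, mul_assoc (word _ _) (star _), ← mul_assoc (star (word (S A) (List.ofFn w))),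
        h2]
      simp

theorem expectation_approx (x : OA A) : ∀ ε > 0, ∃ d ∈ diagonal A, ∃ m : ℕ, ∀ n ≥ m,
    ‖pinch n (gaugeMean x) - d‖ < ε := by
  refine monomial_induction (p := fun x => ∀ ε > 0, ∃ d ∈ diagonal A, ∃ m : ℕ, ∀ n ≥ m,
    ‖pinch n (gaugeMean x) - d‖ < ε) ?_ ?_ ?_ ?_ x
  · refine isClosed_of_closure_subset fun x hx ε hε => ?_
    obtain ⟨y, hy, hxy⟩ := Metric.mem_closure_iff.1 hx (ε / 2) (half_pos hε)
    obtain ⟨d, hd, m, hm⟩ := hy (ε / 2) (half_pos hε)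
    refine ⟨d, hd, m, fun n hn => ?_⟩
    have e : pinch n (gaugeMean x) - d
        = pinch n (gaugeMean (x - y)) + (pinch n (gaugeMean y) - d) := by
      have : x = (x - y) + y := by abel
      conv_lhs => rw [this, gaugeMean_add, pinch_add]
      abel
    rw [e]
    have h1 := (pinch_norm n (gaugeMean (x - y))).trans (gaugeMean_norm (x - y))
    rw [← dist_eq_norm] at h1
    have := norm_add_le (pinch n (gaugeMean (x - y))) (pinch n (gaugeMean y) - d)
    have := hm n hn
    linarith
  · intro μ ν ε hε
    rw [gaugeMean_mono]
    by_cases h : μ.length = ν.length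
    · rw [if_pos h]
      refine ⟨if μ = ν then rangeProj (S A) μ else 0, ?_, μ.length, fun n hn => ?_⟩
      · split_ifs
        · exact rangeProj_mem _
        · exact zero_mem _
      · rw [pinch_mono n μ ν h hn, sub_self, norm_zero]; exact hε
    · rw [if_neg h]
      refine ⟨0, zero_mem _, 0, fun n _ => ?_⟩
      simpa [pinch] using hε
  · intro x y hx hy ε hε
    obtain ⟨d, hd, m, hm⟩ := hx (ε / 2) (half_pos hε)
    obtain ⟨d', hd', m', hm'⟩ := hy (ε / 2) (half_pos hε)
    refine ⟨d + d', add_mem hd hd', max m m', fun n hn => ?_⟩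
    rw [gaugeMean_add, pinch_add, add_sub_add_comm]
    have := norm_add_le (pinch n (gaugeMean x) - d) (pinch n (gaugeMean y) - d')
    have := hm n (le_of_max_le_left hn)
    have := hm' n (le_of_max_le_right hn)
    linarith
  · intro c x hx ε hε
    obtain ⟨d, hd, m, hm⟩ := hx (ε / (‖c‖ + 1)) (by positivity)
    refine ⟨c • d, SMulMemClass.smul_mem _ hd, m, fun n hn => ?_⟩
    rw [gaugeMean_smul, pinch_smul, ← smul_sub, norm_smul]
    have h1 := hm n hn
    rw [lt_div_iff₀ (by positivity)] at h1
    nlinarith [norm_nonneg (pinch n (gaugeMean x) - d)]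

theorem expectation_limit (x : OA A) : ∃ d : DA A,
    Filter.Tendsto (fun n => pinch n (gaugeMean x)) Filter.atTop (nhds (DA.incl A d)) := by
  have hc : CauchySeq (fun n => pinch n (gaugeMean x)) := by
    rw [Metric.cauchySeq_iff']
    intro ε hε
    obtain ⟨d, -, m, hm⟩ := expectation_approx x (ε / 2) (half_pos hε)
    refine ⟨m, fun n hn => ?_⟩
    have h1 := hm n hn
    have h2 := hm m le_rfl
    rw [← dist_eq_norm] at h1 h2
    have := dist_triangle_right (pinch n (gaugeMean x)) (pinch m (gaugeMean x)) d
    linarith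
  obtain ⟨L, hL⟩ := cauchySeq_tendsto_of_complete hc
  have hLd : L ∈ diagonal A := by
    have hcl : L ∈ closure (diagonal A : Set (OA A)) := by
      rw [Metric.mem_closure_iff]
      intro ε hε
      obtain ⟨d, hd, m, hm⟩ := expectation_approx x (ε / 2) (half_pos hε)
      refine ⟨d, hd, ?_⟩
      have : ‖L - d‖ ≤ ε / 2 := le_of_tendsto ((hL.sub_const d).norm)
        (Filter.eventually_atTop.2 ⟨m, fun n hn => (hm n hn).le⟩)
      rw [dist_eq_norm]; linarith
    rwa [diagonal_isClosed.closure_eq] at hcl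
  exact ⟨⟨L, hLd⟩, hL⟩

/-- Averaging over the gauge action and then taking the diagonal part (the limit of the diagonal
parts at all levels). -/
def expectationFun (x : OA A) : DA A := (expectation_limit x).choose

theorem expectationFun_spec (x : OA A) :
    Filter.Tendsto (fun n => pinch n (gaugeMean x)) Filter.atTop
      (nhds (DA.incl A (expectationFun x))) :=
  (expectation_limit x).choose_spec

theorem DA.norm_incl (d : DA A) : ‖DA.incl A d‖ = ‖d‖ := rfl

/-- The canonical conditional expectation `E_A : O_A → D_A`, that is `x ↦ E_D((1/2π) ∫ γ_t(x) dt)`. -/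
def expectation (A : TransitionMatrix N) : OA A →L[ℂ] DA A :=
  LinearMap.mkContinuous
    { toFun := expectationFun
      map_add' := fun x y => DA.incl_injective <| by
        refine tendsto_nhds_unique (expectationFun_spec (x + y)) ?_
        simp_rw [gaugeMean_add, pinch_add, map_add]
        exact (expectationFun_spec x).add (expectationFun_spec y)
      map_smul' := fun c x => DA.incl_injective <| by
        refine tendsto_nhds_unique (expectationFun_spec (c • x)) ?_
        simp_rw [gaugeMean_smul, pinch_smul, map_smul]
        exact (expectationFun_spec x).const_smul c } 1 fun x => by
    rw [one_mul, ← DA.norm_incl]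
    exact le_of_tendsto (expectationFun_spec x).norm
      (Filter.Eventually.of_forall fun n => (pinch_norm n _).trans (gaugeMean_norm x))

/-- `E_A(S_μ S_ν*)` is `S_μ S_μ*` if `μ = ν`, and `0` otherwise. -/
theorem expectation_mono (μ ν : List (Fin N)) :
    expectation A (word (S A) μ * star (word (S A) ν)) = if μ = ν then cylProj A μ else 0 := by
  apply DA.incl_injective
  refine tendsto_nhds_unique (expectationFun_spec _) ?_
  refine tendsto_const_nhds.congr' (Filter.eventually_atTop.2 ⟨μ.length, fun n hn => ?_⟩)
  rw [gaugeMean_mono]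
  by_cases h : μ.length = ν.length
  · rw [if_pos h]
    refine Eq.trans ?_ (pinch_mono n μ ν h hn).symm
    split_ifs <;> simp [DA.incl_cylProj]
  · rw [if_neg h, if_neg (fun e => h (congrArg _ e))]
    simp [pinch]

end Expectation

/-- The inclusion `D_A ⊆ O_A` as a continuous linear map. -/
def DA.inclCLM (A : TransitionMatrix N) : DA A →L[ℂ] OA A where
  toFun x := DA.incl A x
  map_add' := map_add _
  map_smul' := map_smul _
  cont := hom_cont _

/-! ### Hölder functions -/

open scoped Classical in
/-- The metric `d_θ` on `X_A`: `θ^k`, where `k` is the first index at which the points differ. -/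
def shiftDist (θ : ℝ) (x y : ShiftSpace A) : ℝ :=
  if x = y then 0 else θ ^ PiNat.firstDiff x.1 y.1

/-- `p` is `θ`-Hölder continuous, `p ∈ F_θ(X_A)`. -/
def IsHolder (θ : ℝ) (p : C(ShiftSpace A, ℝ)) : Prop :=
  ∃ C : ℝ, ∀ x y, |p x - p y| ≤ C * shiftDist θ x y

end CK

end

noncomputable section

namespace CK

variable {N : ℕ} {A : TransitionMatrix N}

/-! Write $s = \log\beta$. With $\phi = (1-f)s$ one has $e^\phi = \beta\,\beta^{-f}$, and the entire
extension of $t \mapsto \gamma^f_t(S_j)$ is $z \mapsto e^{izf}S_j$, whose value at $z = is$ is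
$\beta^{-f}S_j$. Hence the KMS identity for $x = S_i$, $y = S_i^*a$ reads $\psi(S_i^*a\beta^{-f}S_i)
= \psi(S_iS_i^*a)$. Summing over $i$ with $\sum_i S_iS_i^* = 1$ gives $\varphi\circ\lambda_\phi =
\beta\varphi$; this is `IsKMS.apply_ruelle`.

Conversely, applying the eigenvalue equation to $\beta^f d$ gives $\varphi(\beta^f d) = \sum_i
\varphi(S_i^*dS_i)$ (`eigen_sum_branch`). The expectation $E_A$ is a $\mathcal{D}_A$-bimodule map
and is compatible with $S_j^*\,\cdot\,S_j$. Therefore $\psi = \varphi\circ E_A$ satisfies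
$\psi(wS_j) = \psi(\beta^fS_jw)$ for every $w$ (`eigen_mul_S`), and the analogous rule for $S_j^*$
follows (`eigen_mul_star_S`). These say that $\psi(wy) = \psi(\gamma_{-is}(y)w)$ for the generators
$y$. The rule survives sums and products, so it holds on the $*$-algebra generated by the $S_j$.

For such $y$ and an arbitrary analytic $x$, the function $z \mapsto
\psi(\gamma_{z-is}(y)\gamma_z(x))$ is entire and constant on the real line because $\psi$ is
$\gamma^f$-invariant. Comparing its values at $0$ and $is$ gives the KMS identity (`IsTwisted.kms`).
For fixed $x$ that identity is closed in $y$, so density of the $*$-algebra finishes the proof, and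
no approximation of $x$ is needed. -/

/-! ### The entire family `exp(z f)` in the diagonal -/

/-- The function `exp(z f)`. -/
def cexpFun (f : C(ShiftSpace A, ℝ)) (z : ℂ) : C(ShiftSpace A, ℂ) where
  toFun x := Complex.exp (z * f x)
  continuous_toFun := by fun_prop

/-- Characters separate the points of $\mathcal{D}_A$, commute with the exponential series by
continuity, and evaluate `embed A k` at the associated point of the shift space. Pointwise
exponentials thus become Banach algebra exponentials, whose differentiability in a parameter is
available. -/
theorem embed_exp {g h : C(ShiftSpace A, ℂ)} (H : ∀ x, g x = Complex.exp (h x)) :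
    embed A g = NormedSpace.exp (embed A h) := by
  have key : ∀ (k : C(ShiftSpace A, ℂ)) (χ : WeakDual.characterSpace ℂ (DA A)),
      χ (embed A k) = k (charPoint χ) := fun k χ => by
    change gelfandStarTransform (DA A) ((gelfandStarTransform (DA A)).symm _) χ = _
    rw [StarAlgEquiv.apply_symm_apply]
    rfl
  apply EquivLike.injective (gelfandStarTransform (DA A))
  ext χ
  change χ (embed A g) = χ (NormedSpace.exp (embed A h))
  let : NormedAlgebra ℚ (DA A) := NormedAlgebra.restrictScalars ℚ ℂ (DA A)
  rw [key, H, NormedSpace.map_exp χ (map_continuous χ), key, Complex.exp_eq_exp_ℂ]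

theorem embed_cexpFun (f : C(ShiftSpace A, ℝ)) (z : ℂ) :
    embed A (cexpFun f z)
      = NormedSpace.exp (z • embed A ⟨fun x => (f x : ℂ), by fun_prop⟩) := by
  rw [← map_smul]
  exact embed_exp fun x => rfl

/-- The element `exp(z f)` of `D_A ⊆ O_A`. -/
def expDiag (f : C(ShiftSpace A, ℝ)) (z : ℂ) : OA A := DA.incl A (embed A (cexpFun f z))

theorem expDiag_mem (f : C(ShiftSpace A, ℝ)) (z : ℂ) : expDiag f z ∈ diagonal A :=
  (embed A (cexpFun f z)).2

theorem expDiag_add (f : C(ShiftSpace A, ℝ)) (z w : ℂ) :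
    expDiag f (z + w) = expDiag f z * expDiag f w := by
  rw [expDiag, expDiag, expDiag, ← map_mul, ← map_mul]
  congr 2
  ext x
  simp [cexpFun, ← Complex.exp_add, add_mul]

theorem expDiag_zero (f : C(ShiftSpace A, ℝ)) : expDiag f 0 = 1 := by
  rw [expDiag, show cexpFun f 0 = 1 by ext x; simp [cexpFun], map_one, map_one]

theorem V_eq_expDiag (f : C(ShiftSpace A, ℝ)) (t : ℝ) : V f t = expDiag f (Complex.I * t) := rfl

theorem differentiable_expDiag (f : C(ShiftSpace A, ℝ)) : Differentiable ℂ (expDiag f) := by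
  have h : expDiag f = fun z : ℂ => DA.inclCLM A
      (NormedSpace.exp (z • embed A ⟨fun x => (f x : ℂ), by fun_prop⟩)) := by
    funext z
    rw [← embed_cexpFun]
    rfl
  rw [h]
  exact (DA.inclCLM A).differentiable.comp fun z =>
    (hasDerivAt_exp_smul_const _ z).differentiableAt

/-- The identity $e^{(1-f)\log b} = b\,b^{-f}$ splits the Ruelle weight into the eigenvalue and the
factor produced by the action at imaginary time. -/
theorem expFun_smul_one_sub (f : C(ShiftSpace A, ℝ)) {b : ℝ} (hb : 0 < b) :
    expFun (Real.log b • (1 - f)) = (b : ℂ) • cexpFun f (-(Real.log b : ℂ)) := by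
  ext x
  simp only [expFun, cexpFun, ContinuousMap.coe_mk, ContinuousMap.smul_apply,
    ContinuousMap.sub_apply, ContinuousMap.one_apply, smul_eq_mul]
  conv_rhs => rw [← Real.exp_log hb, Complex.ofReal_exp, ← Complex.exp_add]
  rw [Complex.ofReal_exp, Real.log_exp]
  push_cast
  congr 1
  ring

/-! ### Entire extensions -/

section Entire

variable {B : Type*} [CStarAlgebra B] {α : ℝ → B ≃⋆ₐ[ℂ] B}

/-- Identity theorem: the real points $1/(n+1)$ accumulate at $0$ without reaching it. -/
theorem eq_of_eq_on_real {E : Type*} [NormedAddCommGroup E] [NormedSpace ℂ E] [CompleteSpace E]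
    {F G : ℂ → E} (hF : Differentiable ℂ F) (hG : Differentiable ℂ G)
    (h : ∀ t : ℝ, F t = G t) : F = G := by
  refine AnalyticOnNhd.eq_of_frequently_eq (z₀ := 0) (fun z _ => hF.analyticAt z)
    (fun z _ => hG.analyticAt z) ?_
  have h1 : Filter.Tendsto (fun n : ℕ => (((1 / ((n : ℝ) + 1) : ℝ)) : ℂ)) Filter.atTop
      (nhdsWithin 0 {0}ᶜ) := by
    refine tendsto_nhdsWithin_iff.2 ⟨?_, Filter.Eventually.of_forall fun n => ?_⟩
    · have := (Complex.continuous_ofReal.tendsto 0).comp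
        (tendsto_one_div_add_atTop_nhds_zero_nat (𝕜 := ℝ))
      simpa [Function.comp_def] using this
    · have : (1 / ((n : ℝ) + 1)) ≠ 0 := by positivity
      simpa using (Complex.ofReal_ne_zero.2 this)
  exact h1.frequently (Filter.Frequently.of_forall fun n => h _)

theorem IsEntireExtension.add {x y : B} {F G : ℂ → B} (hF : IsEntireExtension α x F)
    (hG : IsEntireExtension α y G) : IsEntireExtension α (x + y) (fun z => F z + G z) :=
  ⟨hF.1.add hG.1, fun t => by simp only [hF.2, hG.2, map_add]⟩

theorem IsEntireExtension.mul {x y : B} {F G : ℂ → B} (hF : IsEntireExtension α x F)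
    (hG : IsEntireExtension α y G) : IsEntireExtension α (x * y) (fun z => F z * G z) :=
  ⟨hF.1.mul hG.1, fun t => by simp only [hF.2, hG.2, map_mul]⟩

theorem isEntireExtension_algebraMap (c : ℂ) :
    IsEntireExtension α (algebraMap ℂ B c) (fun _ => algebraMap ℂ B c) :=
  ⟨differentiable_const _, fun t => (AlgHomClass.commutes (α t) c).symm⟩

/-- For fixed $t$ both sides are entire in $z$, since $\alpha_t$ is bounded and linear, and they
agree for real $z$ by the group law. -/
theorem IsEntireExtension.apply_add {x : B} {F : ℂ → B} (hF : IsEntireExtension α x F)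
    (hα : ∀ s t y, α s (α t y) = α (s + t) y) (t : ℝ) (z : ℂ) : α t (F z) = F (t + z) := by
  have hc : Continuous (α t) := hom_cont (α t : B →⋆ₐ[ℂ] B)
  let L : B →L[ℂ] B := ⟨(α t : B →⋆ₐ[ℂ] B).toAlgHom.toLinearMap, hc⟩
  refine congrFun (eq_of_eq_on_real (F := fun z => L (F z)) (G := fun z => F (t + z))
    (L.differentiable.comp hF.1) (hF.1.comp (differentiable_id.const_add _)) fun s => ?_) z
  change α t (F s) = F (t + s)
  rw [hF.2, hα, ← Complex.ofReal_add, hF.2]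

/-- The elements `y` with an entire extension `G` along `α` such that `ψ(w y) = ψ(G(-is) w)` for
all `w`. -/
def IsTwisted (α : ℝ → B ≃⋆ₐ[ℂ] B) (s : ℝ) (ψ : B →L[ℂ] ℂ) (y : B) : Prop :=
  ∃ G, IsEntireExtension α y G ∧ ∀ w, ψ (w * y) = ψ (G (-(Complex.I * s)) * w)

variable {s : ℝ} {ψ : B →L[ℂ] ℂ}

theorem IsTwisted.add {x y : B} (hx : IsTwisted α s ψ x) (hy : IsTwisted α s ψ y) :
    IsTwisted α s ψ (x + y) := by
  obtain ⟨F, hF, hx⟩ := hx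
  obtain ⟨G, hG, hy⟩ := hy
  exact ⟨_, hF.add hG, fun w => by rw [mul_add, add_mul, map_add, map_add, hx, hy]⟩

theorem IsTwisted.mul {x y : B} (hx : IsTwisted α s ψ x) (hy : IsTwisted α s ψ y) :
    IsTwisted α s ψ (x * y) := by
  obtain ⟨F, hF, hx⟩ := hx
  obtain ⟨G, hG, hy⟩ := hy
  exact ⟨_, hF.mul hG, fun w => by rw [← mul_assoc, hy, ← mul_assoc, hx, ← mul_assoc]⟩

theorem isTwisted_algebraMap (c : ℂ) : IsTwisted α s ψ (algebraMap ℂ B c) :=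
  ⟨_, isEntireExtension_algebraMap c, fun w => by rw [Algebra.commutes]⟩

/-- The KMS identity follows from the twisted trace property of its second factor. -/
theorem IsTwisted.kms {x y : B} {F : ℂ → B} (hy : IsTwisted α s ψ y)
    (hα : ∀ s t y, α s (α t y) = α (s + t) y) (hψ : ∀ t x, ψ (α t x) = ψ x)
    (hα0 : ∀ y, α 0 y = y) (hF : IsEntireExtension α x F) :
    ψ (y * F (Complex.I * s)) = ψ (x * y) := by
  obtain ⟨G, hG, hy⟩ := hy
  have hF0 : F 0 = x := by simpa [hα0] using hF.2 0
  have hG0 : G 0 = y := by simpa [hα0] using hG.2 0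
  -- At a real $t$ the argument of $\psi$ is $\alpha_t(G(-is)x)$. Invariance removes $\alpha_t$, and
  -- the twisted trace property with $w = x$ turns the value into $\psi(xy)$. At $z = is$ the first
  -- factor becomes $G(0) = y$.
  have hc := eq_of_eq_on_real (F := fun z => ψ (G (z - Complex.I * s) * F z))
    (G := fun _ => ψ (x * y))
    (ψ.differentiable.comp ((hG.1.comp (differentiable_id.sub_const _)).mul hF.1))
    (differentiable_const _) fun t => by
      rw [sub_eq_add_neg, ← hG.apply_add hα, hF.2, ← map_mul, hψ, hy]
  have := congrFun hc (Complex.I * s)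
  simpa [hG0] using this

end Entire

/-! ### The group law of the generalized gauge action and the analyticity of the generators -/

theorem gamma_add (f : C(ShiftSpace A, ℝ)) (s t : ℝ) (x : OA A) :
    gamma f s (gamma f t x) = gamma f (s + t) x := gammaHom_add f s t x

theorem gamma_zero (f : C(ShiftSpace A, ℝ)) (x : OA A) : gamma f 0 x = x := gammaHom_zero f x

theorem gamma_diagonal (f : C(ShiftSpace A, ℝ)) (t : ℝ) {d : OA A} (hd : d ∈ diagonal A) :
    gamma f t d = d := gammaHom_diagonal f t hd

/-- On a generator both orders produce two commuting unitaries of $\mathcal{D}_A$ in front of $S_j$,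
because each action fixes the diagonal. With one action the gauge action, this makes the gauge
average commute with $\gamma^f$. -/
theorem gamma_comm (f g : C(ShiftSpace A, ℝ)) (s t : ℝ) (x : OA A) :
    gamma f s (gamma g t x) = gamma g t (gamma f s x) := by
  have : (gammaHom f s).comp (gammaHom g t) = (gammaHom g t).comp (gammaHom f s) :=
    hom_ext fun j => by
      rw [StarAlgHom.comp_apply, StarAlgHom.comp_apply, gammaHom_S, gammaHom_S, map_mul, map_mul,
        gammaHom_S, gammaHom_S, gammaHom_diagonal f s (V_mem g t),
        gammaHom_diagonal g t (V_mem f s), ← mul_assoc, ← mul_assoc,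
        diagonal_comm (V_mem g t) (V_mem f s)]
  exact DFunLike.congr_fun this x

theorem isEntireExtension_S (f : C(ShiftSpace A, ℝ)) (j : Fin N) :
    IsEntireExtension (gamma f) (S A j) (fun z => expDiag f (Complex.I * z) * S A j) := by
  refine ⟨((differentiable_expDiag f).comp
    (differentiable_id.const_mul _)).mul (differentiable_const _), fun t => ?_⟩
  rw [gamma_S]
  rfl

/-- The adjoint of the extension of $S_j$ would be antiholomorphic in $z$. Replacing $V_t^*$ by
$V_{-t}$ before extending gives a holomorphic formula. -/
theorem isEntireExtension_star_S (f : C(ShiftSpace A, ℝ)) (j : Fin N) :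
    IsEntireExtension (gamma f) (star (S A j))
      (fun z => star (S A j) * expDiag f (-(Complex.I * z))) := by
  refine ⟨(differentiable_const _).mul ((differentiable_expDiag f).comp
    (differentiable_id.const_mul _).neg), fun t => ?_⟩
  rw [map_star, gamma_S, star_mul, star_V, V_eq_expDiag]
  push_cast
  rw [mul_neg]

/-! ### Properties of the conditional expectation -/

/-- A bounded linear map passes through the integral, so commuting with the gauge action suffices.
The compatibility properties of the mean are instances of this. -/
theorem gaugeMean_comm (L : OA A →L[ℂ] OA A)
    (hL : ∀ (t : ℝ) x, gamma (1 : C(ShiftSpace A, ℝ)) t (L x) = L (gamma 1 t x)) (x : OA A) :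
    gaugeMean (L x) = L (gaugeMean x) := by
  simp only [gaugeMean, hL, map_smul]
  rw [L.intervalIntegral_comp_comm ((gauge_continuous x).intervalIntegrable _ _)]

theorem gaugeMean_mul_left {d : OA A} (hd : d ∈ diagonal A) (x : OA A) :
    gaugeMean (d * x) = d * gaugeMean x :=
  gaugeMean_comm (ContinuousLinearMap.mul ℂ (OA A) d)
    (fun t y => by simp [gamma_diagonal 1 t hd]) x

theorem gaugeMean_mul_right {d : OA A} (hd : d ∈ diagonal A) (x : OA A) :
    gaugeMean (x * d) = gaugeMean x * d :=
  gaugeMean_comm ((ContinuousLinearMap.mul ℂ (OA A)).flip d)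
    (fun t y => by simp [gamma_diagonal 1 t hd]) x

theorem gauge_S (t : ℝ) (j : Fin N) :
    gamma (1 : C(ShiftSpace A, ℝ)) t (S A j) = Complex.exp (Complex.I * t) • S A j := by
  simpa [word] using gauge_word (A := A) t [j]

/-- Conjugation by $S_j$ has gauge degree zero: the phases $e^{it}$ and $e^{-it}$ cancel. -/
theorem gaugeMean_conj_S (j : Fin N) (x : OA A) :
    gaugeMean (star (S A j) * x * S A j) = star (S A j) * gaugeMean x * S A j := by
  have h := gaugeMean_comm (((ContinuousLinearMap.mul ℂ (OA A)).flip (S A j)).comp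
    (ContinuousLinearMap.mul ℂ (OA A) (star (S A j)))) (fun t y => ?_) x
  · simpa using h
  · simp only [ContinuousLinearMap.comp_apply, ContinuousLinearMap.mul_apply',
      ContinuousLinearMap.flip_apply, map_mul, map_star, gauge_S, star_smul, smul_mul_assoc,
      mul_smul_comm, smul_smul]
    have : Complex.exp (Complex.I * t) * star (Complex.exp (Complex.I * t)) = 1 := by
      rw [show star (Complex.exp (Complex.I * t)) = Complex.exp (-(Complex.I * t)) by
        simp [← Complex.exp_conj], ← Complex.exp_add, add_neg_cancel, Complex.exp_zero]
    rw [this, one_smul]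

theorem gaugeMean_gamma (f : C(ShiftSpace A, ℝ)) (t : ℝ) (x : OA A) :
    gaugeMean (gamma f t x) = gamma f t (gaugeMean x) :=
  gaugeMean_comm ⟨(gammaHom f t).toAlgHom.toLinearMap, hom_cont (gammaHom f t)⟩
    (fun s y => gamma_comm 1 f s t y) x

theorem pinch_mul_left (n : ℕ) {d : OA A} (hd : d ∈ diagonal A) (x : OA A) :
    pinch n (d * x) = d * pinch n x := by
  simp only [pinch, Finset.mul_sum]
  refine Finset.sum_congr rfl fun w _ => ?_
  rw [← mul_assoc, diagonal_comm (rangeProj_mem _) hd]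
  simp only [mul_assoc]

theorem pinch_mul_right (n : ℕ) {d : OA A} (hd : d ∈ diagonal A) (x : OA A) :
    pinch n (x * d) = pinch n x * d := by
  simp only [pinch, Finset.sum_mul]
  refine Finset.sum_congr rfl fun w _ => ?_
  rw [mul_assoc, mul_assoc, diagonal_comm hd (rangeProj_mem _)]
  simp only [mul_assoc]

theorem pinch_gamma (n : ℕ) (f : C(ShiftSpace A, ℝ)) (t : ℝ) (x : OA A) :
    pinch n (gamma f t x) = gamma f t (pinch n x) := by
  simp only [pinch, map_sum, map_mul, gamma_diagonal f t (rangeProj_mem _)]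

/-- The source projection $S_j^*S_j$ is diagonal, hence commutes with $S_\mu S_\mu^*$ and can be
absorbed into $S_j$. Passing a word projection across $S_j$ therefore prepends the letter $j$. -/
theorem S_mul_rangeProj (j : Fin N) (μ : List (Fin N)) :
    S A j * rangeProj (S A) μ = rangeProj (S A) (j :: μ) * S A j := by
  have hq : star (S A j) * S A j ∈ diagonal A := by simpa using conj_S_mem j (one_mem (diagonal A))
  rw [rangeProj_cons, mul_assoc, mul_assoc, diagonal_comm (rangeProj_mem μ) hq, ← mul_assoc,
    ← mul_assoc, S_isCK.partial_isometry]

/-- Split the words of length $n+1$ by their first letter. Those not beginning with $j$ are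
annihilated by $S_j^*$; for the others the projections pass through $S_j$ and lose that letter,
whence the shift from $n+1$ to $n$. -/
theorem pinch_conj_S (n : ℕ) (j : Fin N) (x : OA A) :
    pinch n (star (S A j) * x * S A j) = star (S A j) * pinch (n + 1) x * S A j := by
  rw [pinch, pinch, sum_words_succ n fun l => rangeProj (S A) l * x * rangeProj (S A) l,
    Finset.mul_sum, Finset.sum_mul, Finset.sum_eq_single j]
  · rw [Finset.mul_sum, Finset.sum_mul]
    refine Finset.sum_congr rfl fun w _ => ?_
    have h1 := S_mul_rangeProj (A := A) j (List.ofFn w)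
    have h2 := congrArg star h1
    rw [star_mul, star_mul, star_rangeProj, star_rangeProj] at h2
    calc _ = (rangeProj (S A) (List.ofFn w) * star (S A j)) * x
          * (S A j * rangeProj (S A) (List.ofFn w)) := by simp only [mul_assoc]
      _ = _ := by rw [h1, h2]; simp only [mul_assoc]
  · intro i _ hij
    rw [Finset.mul_sum, Finset.sum_mul]
    refine Finset.sum_eq_zero fun w _ => ?_
    rw [rangeProj_cons]
    simp only [← mul_assoc]
    rw [S_isCK.orth hij.symm]
    simp
  · simp

theorem expectation_spec (x : OA A) :
    Filter.Tendsto (fun n => pinch n (gaugeMean x)) Filter.atTop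
      (nhds (DA.incl A (expectation A x))) := expectationFun_spec x

theorem incl_expectation_eq {x d : OA A}
    (h : Filter.Tendsto (fun n => pinch n (gaugeMean x)) Filter.atTop (nhds d)) :
    DA.incl A (expectation A x) = d := tendsto_nhds_unique (expectation_spec x) h

/-- `E_A` is a left `D_A`-module map. -/
theorem expectation_mul_left (d : DA A) (x : OA A) :
    expectation A (DA.incl A d * x) = d * expectation A x := by
  apply DA.incl_injective
  refine incl_expectation_eq ?_
  have hd : DA.incl A d ∈ diagonal A := d.2
  simp_rw [gaugeMean_mul_left hd, pinch_mul_left _ hd, map_mul]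
  exact (expectation_spec x).const_mul _

/-- `E_A` is a right `D_A`-module map. -/
theorem expectation_mul_right (d : DA A) (x : OA A) :
    expectation A (x * DA.incl A d) = expectation A x * d := by
  apply DA.incl_injective
  refine incl_expectation_eq ?_
  have hd : DA.incl A d ∈ diagonal A := d.2
  simp_rw [gaugeMean_mul_right hd, pinch_mul_right _ hd, map_mul]
  exact (expectation_spec x).mul_const _

/-- Conjugation by $S_j$ lowers the level of the diagonal part by one, which does not affect the
limit over levels. -/
theorem expectation_conj_S (j : Fin N) (x : OA A) :
    DA.incl A (expectation A (star (S A j) * x * S A j))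
      = star (S A j) * DA.incl A (expectation A x) * S A j := by
  refine incl_expectation_eq ?_
  simp_rw [gaugeMean_conj_S, pinch_conj_S]
  exact (((expectation_spec x).comp (Filter.tendsto_add_atTop_nat 1)).const_mul _).mul_const _

/-- Averaging and pinching commute with $\gamma^f_t$, which fixes the limit since that lies in
$\mathcal{D}_A$. This yields the invariance of $\varphi\circ E_A$ used in `IsTwisted.kms`. -/
theorem expectation_gamma (f : C(ShiftSpace A, ℝ)) (t : ℝ) (x : OA A) :
    expectation A (gamma f t x) = expectation A x := by
  apply DA.incl_injective
  refine incl_expectation_eq ?_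
  simp_rw [gaugeMean_gamma, pinch_gamma]
  have hc : Continuous (gamma f t : OA A → OA A) := hom_cont (gammaHom f t)
  have hd : gamma f t (DA.incl A (expectation A x)) = DA.incl A (expectation A x) :=
    gamma_diagonal f t (expectation A x).2
  have := (hc.tendsto _).comp (expectation_spec x)
  rwa [hd] at this

theorem expectation_one : expectation A 1 = 1 := by
  have h := expectation_mono (A := A) [] []
  have h1 : cylProj A [] = 1 := DA.incl_injective rangeProj_nil
  simpa [word_nil, h1] using h

/-- `E_A` is positive. -/
theorem expectation_star_mul_self (x : OA A) :
    ∃ b : DA A, expectation A (star x * x) = star b * b := by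
  let := CStarAlgebra.spectralOrder (OA A)
  have := CStarAlgebra.spectralOrderedRing (OA A)
  let := CStarAlgebra.spectralOrder (DA A)
  have := CStarAlgebra.spectralOrderedRing (DA A)
  have hcl : IsClosed {a : OA A | 0 ≤ a} := CStarAlgebra.isClosed_nonneg
  have h1 : (0 : OA A) ≤ gaugeMean (star x * x) := by
    -- Closedness of the positive cone is what makes the integral of a positive function positive.
    have hci : ClosedIciTopology (OA A) := ⟨fun a => by
      have : Set.Ici a = (fun y => y - a) ⁻¹' {a : OA A | 0 ≤ a} := by
        ext y; simp [Set.mem_Ici, sub_nonneg]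
      rw [this]
      exact hcl.preimage (by fun_prop)⟩
    have hi : (0 : OA A) ≤ ∫ t in (0 : ℝ)..(2 * Real.pi),
        gamma (1 : C(ShiftSpace A, ℝ)) t (star x * x) := by
      rw [intervalIntegral.integral_of_le Real.two_pi_pos.le]
      refine MeasureTheory.integral_nonneg fun t => ?_
      change 0 ≤ gamma _ t (star x * x)
      rw [map_mul, map_star]
      exact star_mul_self_nonneg _
    have e : gaugeMean (star x * x) = ((2 * Real.pi)⁻¹ : ℝ) • ∫ t in (0 : ℝ)..(2 * Real.pi),
        gamma (1 : C(ShiftSpace A, ℝ)) t (star x * x) := by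
      rw [gaugeMean, ← Complex.coe_smul]
      push_cast
      rfl
    rw [e]
    exact smul_nonneg (by positivity) hi
  have h2 : (0 : OA A) ≤ DA.incl A (expectation A (star x * x)) := by
    refine hcl.mem_of_tendsto (expectation_spec (star x * x))
      (Filter.Eventually.of_forall fun n => ?_)
    refine Finset.sum_nonneg (N := OA A) fun w _ => ?_
    -- Each summand of the diagonal part has the form $PaP$ with $P$ a projection and $a$ positive.
    have := star_left_conjugate_nonneg h1 (rangeProj (S A) (List.ofFn w))
    rwa [star_rangeProj] at this
  have h3 : 0 ≤ expectation A (star x * x) := by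
    set d := expectation A (star x * x)
    -- Positivity is known in $\mathcal{O}_A$ but is needed in $\mathcal{D}_A$. It descends because
    -- an element of a closed $*$-subalgebra has the same complex spectrum in both algebras; the
    -- real spectrum is compared through the complex one.
    have hsa : IsSelfAdjoint d := by
      apply DA.incl_injective
      rw [map_star]
      exact (IsSelfAdjoint.of_nonneg h2).star_eq
    rw [StarOrderedRing.nonneg_iff_spectrum_nonneg (R := ℝ) d hsa]
    intro r hr
    refine spectrum_nonneg_of_nonneg h2 ?_
    have hC : (r : ℂ) ∈ spectrum ℂ d := by
      have := spectrum.algebraMap_mem ℂ hr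
      simpa using this
    have e : spectrum ℂ d = spectrum ℂ (DA.incl A d) :=
      StarSubalgebra.spectrum_eq (S := diagonal A) (hS := diagonal_isClosed) (a := d)
    rw [e] at hC
    exact spectrum.of_algebraMap_mem ℂ (by simpa using hC)
  obtain ⟨b, hb⟩ := CStarAlgebra.nonneg_iff_eq_star_mul_self.1 h3
  exact ⟨b, hb⟩

/-! ### States on the algebra and on its diagonal -/

theorem IsState.comp_expectation {ω : DA A →L[ℂ] ℂ} (hω : IsState ω) :
    IsState (ω.comp (expectation A)) where
  nonneg x := by
    obtain ⟨b, hb⟩ := expectation_star_mul_self x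
    rw [ContinuousLinearMap.comp_apply, hb]
    exact hω.nonneg b
  map_one := by rw [ContinuousLinearMap.comp_apply, expectation_one, hω.map_one]

theorem IsState.comp_inclCLM {ψ : OA A →L[ℂ] ℂ} (hψ : IsState ψ) :
    IsState (ψ.comp (DA.inclCLM A)) where
  nonneg a := by
    have : DA.inclCLM A (star a * a) = star (DA.incl A a) * DA.incl A a := by
      rw [← map_star, ← map_mul]; rfl
    rw [ContinuousLinearMap.comp_apply, this]
    exact hψ.nonneg _
  map_one := by
    have : DA.inclCLM A (1 : DA A) = 1 := _root_.map_one (DA.incl A)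
    rw [ContinuousLinearMap.comp_apply, this, hψ.map_one]

/-! ### KMS states and eigenstates of the Ruelle operator -/

theorem incl_ruelle (p : C(ShiftSpace A, ℝ)) (a : DA A) :
    DA.incl A (ruelle p a)
      = ∑ i, star (S A i) * (DA.incl A a * DA.incl A (embed A (expFun p))) * S A i := by
  rw [← map_mul]
  rfl

/-- The operator `d ↦ S_i^* d S_i` on `D_A`. -/
def branch (i : Fin N) (d : DA A) : DA A :=
  ⟨star (S A i) * DA.incl A d * S A i, conj_S_mem i d.2⟩

theorem incl_branch (i : Fin N) (d : DA A) :
    DA.incl A (branch i d) = star (S A i) * DA.incl A d * S A i := rfl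

theorem embed_expFun_smul_one_sub (f : C(ShiftSpace A, ℝ)) {b : ℝ} (hb : 0 < b) :
    DA.incl A (embed A (expFun (Real.log b • (1 - f))))
      = (b : ℂ) • expDiag f (-(Real.log b : ℂ)) := by
  rw [expFun_smul_one_sub f hb, map_smul, map_smul]
  rfl

theorem IsKMS.apply_ruelle {f : C(ShiftSpace A, ℝ)} {b : ℝ} (hb : 0 < b) {ψ : OA A →L[ℂ] ℂ}
    (hψ : IsKMS (gamma f) (Real.log b) ψ) (a : DA A) :
    ψ (DA.incl A (ruelle (Real.log b • (1 - f)) a)) = (b : ℂ) * ψ (DA.incl A a) := by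
  have h1 : ∀ i, ψ (star (S A i) * (DA.incl A a * expDiag f (-(Real.log b : ℂ))) * S A i)
      = ψ (S A i * star (S A i) * DA.incl A a) := fun i => by
    -- The KMS identity with $x = S_i$ and $y = S_i^*a$; as $i\cdot(i\log b) = -\log b$, the
    -- extension contributes $b^{-f}$.
    have := hψ.2 _ _ (isEntireExtension_S f i) (star (S A i) * DA.incl A a)
    rw [← mul_assoc Complex.I, Complex.I_mul_I, neg_one_mul] at this
    simpa only [mul_assoc] using this
  rw [incl_ruelle, embed_expFun_smul_one_sub f hb]
  simp_rw [mul_smul_comm, smul_mul_assoc]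
  rw [← Finset.smul_sum, map_smul, map_sum, smul_eq_mul]
  simp_rw [h1]
  rw [← map_sum, ← Finset.sum_mul, S_isCK.sum_range, one_mul]

/-! ### From an eigenstate of the Ruelle operator to the twisted trace property -/

section Eigenstate

variable {f : C(ShiftSpace A, ℝ)} {b : ℝ} {ω : DA A →L[ℂ] ℂ}

/-- The choice $a = b^fd$ cancels the factor $b^{-f}$ in the Ruelle weight, and the remaining $b$
cancels the eigenvalue. -/
theorem eigen_sum_branch (hb : 0 < b)
    (hω : ∀ a, ω (ruelle (Real.log b • (1 - f)) a) = (b : ℂ) * ω a) (d : DA A) :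
    ω (embed A (cexpFun f (Real.log b)) * d) = ∑ i, ω (branch i d) := by
  have hb' : (b : ℂ) ≠ 0 := by exact_mod_cast hb.ne'
  have h := hω (embed A (cexpFun f (Real.log b)) * d)
  have e : ruelle (Real.log b • (1 - f)) (embed A (cexpFun f (Real.log b)) * d)
      = (b : ℂ) • ∑ i, branch i d := by
    apply DA.incl_injective
    rw [incl_ruelle, embed_expFun_smul_one_sub f hb, map_smul, map_sum, Finset.smul_sum]
    refine Finset.sum_congr rfl fun i _ => ?_
    have : DA.incl A (embed A (cexpFun f (Real.log b)) * d) * expDiag f (-(Real.log b : ℂ))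
        = DA.incl A d := by
      rw [mul_comm, map_mul, mul_assoc]
      change DA.incl A d * (expDiag f _ * _) = _
      rw [← expDiag_add, add_neg_cancel, expDiag_zero, mul_one]
    rw [mul_smul_comm, this, incl_branch, mul_smul_comm, smul_mul_assoc]
  rw [e, map_smul, smul_eq_mul] at h
  rw [← mul_left_cancel₀ hb' h, map_sum]

/-- By the module property $E_A(S_jw)$ carries the factor $S_jS_j^*$ on the left, and $S_i^*S_j =
0$. -/
theorem branch_expectation_S_mul {i j : Fin N} (h : i ≠ j) (w : OA A) :
    branch i (expectation A (S A j * w)) = 0 := by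
  have h1 : S A j * w = DA.incl A (cylProj A [j]) * (S A j * w) := by
    rw [DA.incl_cylProj, ← S_range, ← mul_assoc, S_isCK.partial_isometry]
  apply DA.incl_injective
  rw [h1, expectation_mul_left, incl_branch, map_mul, DA.incl_cylProj, ← S_range, ← mul_assoc,
    ← mul_assoc, S_isCK.orth h]
  simp

/-- The bimodule property and commutativity of $\mathcal{D}_A$ put the diagonal in the centralizer
of $\omega\circ E_A$. -/
theorem eigen_mul_comm (d : DA A) (x : OA A) :
    ω (expectation A (DA.incl A d * x)) = ω (expectation A (x * DA.incl A d)) := by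
  rw [expectation_mul_left, expectation_mul_right, mul_comm]

/-- Pull $b^f$ out of $E_A$ and apply `eigen_sum_branch` to $E_A(S_jw)$. Only the branch $j$
survives, leaving $\omega(E_A(S_j^*S_jwS_j))$. The diagonal projection $S_j^*S_j$ moves to the right
end, where $S_j$ absorbs it. -/
theorem eigen_mul_S (hb : 0 < b)
    (hω : ∀ a, ω (ruelle (Real.log b • (1 - f)) a) = (b : ℂ) * ω a) (j : Fin N) (w : OA A) :
    ω (expectation A (w * S A j)) = ω (expectation A (expDiag f (Real.log b) * S A j * w)) := by
  have hR : ω (expectation A (expDiag f (Real.log b) * S A j * w))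
      = ω (branch j (expectation A (S A j * w))) := by
    rw [mul_assoc, expDiag, expectation_mul_left, eigen_sum_branch hb hω, Finset.sum_eq_single j]
    · intro i _ hij
      rw [branch_expectation_S_mul hij, map_zero]
    · simp
  have hq : DA.incl A (branch j 1) = star (S A j) * S A j := by
    rw [incl_branch, map_one, mul_one]
  have e1 : w * S A j = w * S A j * DA.incl A (branch j 1) := by
    rw [hq, mul_assoc, ← mul_assoc (S A j), S_isCK.partial_isometry]
  have e2 : branch j (expectation A (S A j * w))
      = expectation A (star (S A j) * (S A j * w) * S A j) := by
    apply DA.incl_injective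
    rw [expectation_conj_S, incl_branch]
  rw [hR, e1, ← eigen_mul_comm, e2, hq]
  simp only [mul_assoc]

/-- This is the rule for $S_j$ read backwards: diagonal projections are inserted so that a factor
$S_j$ appears, `eigen_mul_S` moves it to the front, and the projections are absorbed again. -/
theorem eigen_mul_star_S (hb : 0 < b)
    (hω : ∀ a, ω (ruelle (Real.log b • (1 - f)) a) = (b : ℂ) * ω a) (j : Fin N) (w : OA A) :
    ω (expectation A (w * star (S A j)))
      = ω (expectation A (star (S A j) * expDiag f (-(Real.log b : ℂ)) * w)) := by
  have hq : DA.incl A (branch j 1) = star (S A j) * S A j := by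
    rw [incl_branch, map_one, mul_one]
  have hst : star (S A j) * S A j * star (S A j) = star (S A j) := by
    simpa [mul_assoc] using congrArg star (S_isCK.partial_isometry (A := A) j)
  set v := expDiag f (-(Real.log b : ℂ)) * w with hv
  have hp : expDiag f (Real.log b) * (S A j * star (S A j))
      = S A j * star (S A j) * expDiag f (Real.log b) :=
    diagonal_comm (expDiag_mem f _) (by rw [S_range]; exact rangeProj_mem _)
  symm
  calc ω (expectation A (star (S A j) * expDiag f (-(Real.log b : ℂ)) * w))
      = ω (expectation A (DA.incl A (branch j 1) * (star (S A j) * v))) := by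
        rw [hq, ← mul_assoc, hst, hv, mul_assoc]
    _ = ω (expectation A (star (S A j) * v * star (S A j) * S A j)) := by
        rw [eigen_mul_comm, hq]
        simp only [mul_assoc]
    -- Here `eigen_mul_S` is used with $S_j^*vS_j^*$ in the role of $w$.
    _ = ω (expectation A (expDiag f (Real.log b) * (S A j * star (S A j)) * v
          * star (S A j))) := by
        rw [eigen_mul_S hb hω]
        simp only [mul_assoc]
    _ = ω (expectation A (DA.incl A (cylProj A [j])
          * (expDiag f (Real.log b) * v * star (S A j)))) := by
        rw [hp, DA.incl_cylProj, ← S_range]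
        simp only [mul_assoc]
    -- The projection $S_jS_j^*$ moves cyclically to the right end and is absorbed by $S_j^*$.
    _ = ω (expectation A (expDiag f (Real.log b) * v * star (S A j))) := by
        rw [eigen_mul_comm, DA.incl_cylProj, ← S_range, mul_assoc, ← mul_assoc (star (S A j)), hst]
    _ = ω (expectation A (w * star (S A j))) := by
        rw [hv, ← mul_assoc, ← expDiag_add, add_neg_cancel, expDiag_zero, one_mul]

theorem isTwisted_of_mem_adjoin (hb : 0 < b)
    (hω : ∀ a, ω (ruelle (Real.log b • (1 - f)) a) = (b : ℂ) * ω a) {y : OA A}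
    (hy : y ∈ StarAlgebra.adjoin ℂ (Set.range (S A))) :
    IsTwisted (gamma f) (Real.log b) (ω.comp (expectation A)) y := by
  have hI : Complex.I * -(Complex.I * (Real.log b : ℂ)) = Real.log b := by
    rw [mul_neg, ← mul_assoc, Complex.I_mul_I, neg_one_mul, neg_neg]
  -- Viewing the $*$-algebra as the plain algebra generated by the $S_j$ and the $S_j^*$ avoids an
  -- induction step for adjoints.
  rw [← StarSubalgebra.mem_toSubalgebra, StarAlgebra.adjoin_toSubalgebra] at hy
  induction hy using Algebra.adjoin_induction with
  | mem x hx =>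
    rcases hx with ⟨j, rfl⟩ | ⟨j, hj⟩
    · refine ⟨_, isEntireExtension_S f j, fun w => ?_⟩
      simp only [hI]
      exact eigen_mul_S hb hω j w
    · rw [← star_star x, ← hj]
      refine ⟨_, isEntireExtension_star_S f j, fun w => ?_⟩
      simp only [hI]
      exact eigen_mul_star_S hb hω j w
  | algebraMap r => exact isTwisted_algebraMap r
  | add x y _ _ hx hy => exact hx.add hy
  | mul x y _ _ hx hy => exact hx.mul hy

theorem IsState.isKMS_comp_expectation (hb : 0 < b) (hs : IsState ω)
    (hω : ∀ a, ω (ruelle (Real.log b • (1 - f)) a) = (b : ℂ) * ω a) :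
    IsKMS (gamma f) (Real.log b) (ω.comp (expectation A)) := by
  refine ⟨hs.comp_expectation, fun x F hF y => ?_⟩
  -- The analytic element $x$ and its extension stay fixed. Both sides are continuous in $y$, so $y$
  -- may be taken in the dense $*$-algebra.
  refine closure_induction (p := fun y => (ω.comp (expectation A)) (y * F (Complex.I * Real.log b))
    = (ω.comp (expectation A)) (x * y)) (isClosed_eq (by fun_prop) (by fun_prop))
    (fun y hy => ?_) y
  exact (isTwisted_of_mem_adjoin hb hω hy).kms (gamma_add f)
    (fun t x => congrArg ω (expectation_gamma f t x)) (gamma_zero f) hF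

end Eigenstate

end CK
end

theorem proposition2p2 (N : ℕ) (hN : 1 < N) (A : CK.TransitionMatrix N)
    (hirr : ∀ i j, ∃ k : ℕ, 0 < k ∧ 0 < (A.entry ^ k) i j)
    (hperm : ¬ ∃ σ : Equiv.Perm (Fin N), A.entry = σ.permMatrix ℕ)
    (θ : ℝ) (hθ0 : 0 < θ) (hθ1 : θ < 1) :
    (∀ f : C(CK.ShiftSpace A, ℝ), CK.IsHolder θ f → ∀ β : ℝ, 1 < β →
      ∀ ψ : CK.OA A →L[ℂ] ℂ, CK.IsKMS (CK.gamma f) (Real.log β) ψ →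
        CK.IsState (ψ.comp (CK.DA.inclCLM A)) ∧
        ∀ a : CK.DA A, (ψ.comp (CK.DA.inclCLM A)) (CK.ruelle (Real.log β • (1 - f)) a)
          = (β : ℂ) * (ψ.comp (CK.DA.inclCLM A)) a) ∧
    (∀ p : C(CK.ShiftSpace A, ℝ), CK.IsHolder θ p → ∀ β : ℝ, 1 < β →
      ∀ ω : CK.DA A →L[ℂ] ℂ, CK.IsState ω →
        (∀ a : CK.DA A, ω (CK.ruelle p a) = (β : ℂ) * ω a) →
        CK.IsState (ω.comp (CK.expectation A)) ∧
        CK.IsKMS (CK.gamma (1 - (Real.log β)⁻¹ • p)) (Real.log β)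
          (ω.comp (CK.expectation A))) := by
  refine ⟨fun f _ β hβ ψ hψ => ⟨hψ.1.comp_inclCLM, fun a => hψ.apply_ruelle (by linarith) a⟩,
    fun p _ β hβ ω hs hω => ?_⟩
  -- Solving $f = 1 - \phi/\log\beta$ for $\phi$ needs $\log\beta \neq 0$, which $\beta > 1$
  -- provides.
  have hp : Real.log β • (1 - (1 - (Real.log β)⁻¹ • p)) = p := by
    rw [sub_sub_cancel, smul_inv_smul₀ (Real.log_pos hβ).ne']
  exact ⟨hs.comp_expectation,
    hs.isKMS_comp_expectation (by linarith) fun a => by rw [hp]; exact hω a⟩
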